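/- All matroids are finite. For a matroid $M$ on ground set $E$ with rank function $r$, let $L(M)$ be its lattice of flats and $$\chi(M,t)=\sum_{F\in L(M)}\mu(F)\,t^{\,r(M)-r(F)}\in\mathbb{Z}[t]$$ its characteristic polynomial, where $\mu(\hat 0)=1$ and $\mu(F)=-\sum_{G<F}\mu(G)$ for $F\neq\hat 0$ (sum over flats $G$). Write $M|X$ and $M/X$ for restriction and contraction, and $\mathrm{si}(M)$ for the simplification of $M$ (delete all loops and all but one element of each parallel class). A flat $X$ is \emph{modular} if $r(X)+r(Y)=r(X\cap Y)+r(X\vee Y)$ for every flat $Y$, where $X\vee Y$ is the closure of $X\cup Y$; a \emph{coatom} is a flat of corank $1$. A matroid is \emph{round} if its ground set is not the union of two proper flats. A simple matroid $M$ is the \emph{modular join} of $M|E_1$ and $M|E_2$ over $X=E_1\cap E_2$ if $E_1,E_2$ are proper modular flats of $M$ with $E=E_1\cup E_2$. Let $\mathcal{ME}$ (the \emph{modularly extended} matroids) be the smallest class of simple matroids such that (i) the empty matroid belongs to $\mathcal{ME}$; (ii) if a simple matroid $M$ has a modular coatom $X$ with $M|X\in\mathcal{ME}$, then $M\in\mathcal{ME}$;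 (iii) if a simple matroid $M$ is the modular join of $M_1,M_2\in\mathcal{ME}$ over a flat $X$ such that $M|X$ is round, then $M\in\mathcal{ME}$. A \emph{divisional flag} of a simple matroid $M$ of rank $n$ is a chain of flats $\varnothing=X_0\subseteq X_1\subseteq\dots\subseteq X_n=E$ with $r(X_i)=i$ for $0\le i\le n$ and $\chi(M/X_{i+1},t)\mid\chi(M/X_i,t)$ for $0\le i\le n-1$. An element $e$ of a simple matroid $M$ is a \emph{divisional atom} if $\chi(M/e,t)\mid\chi(M,t)$. A (central) arrangement $\mathcal{A}$ over a field $\mathbb{K}$ is a finite set of subspaces of codimension $1$ in a finite-dimensional $\mathbb{K}$-vector space; its linear dependence matroid $M(\mathcal{A})$ is the simple matroid on the set $\mathcal{A}$ in which $\{H_1,\dots,H_n\}\subseteq\mathcal{A}$ (the $H_i$ distinct) is independent if and only if $\operatorname{codim}(H_1\cap\dots\cap H_n)=n$. The arrangement $\mathcal{A}$ is \emph{divisionally free} if $M(\mathcal{A})$ has a divisional flag. \textbf{Theorem.} (a) Every modularly extended matroid has a divisional flag. (b) If the linear dependence matroid $M(\mathcal{A})$ of an arrangement $\mathcal{A}$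 over a field is modularly extended, then $\mathcal{A}$ is divisionally free. (c) Every modularly extended matroid $M$ with nonempty ground set has a divisional atom $e$ such that $\mathrm{si}(M/e)$ is again modularly extended. -/

import Mathlib

open Polynomial
open scoped Matroid

namespace ModularConstruction

section Matroids

variable {α : Type*}

/-- `M` is a simple matroid on a finite ground set: no loops (`e = f`) and no two
distinct parallel elements (`e ≠ f`). -/
structure IsSimple (M : Matroid α) : Prop where
  finite : M.Finite
  indep_pair : ∀ e ∈ M.E, ∀ f ∈ M.E, M.Indep {e, f}

/-- A modular flat: a modular element of the lattice of flats, in which the meet is the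
intersection and the join is the closure of the union. -/
structure IsModularFlat (M : Matroid α) (X : Set α) : Prop where
  isFlat : M.IsFlat X
  modular : ∀ Y, M.IsFlat Y →
    M.eRk X + M.eRk Y = M.eRk (X ∩ Y) + M.eRk (M.closure (X ∪ Y))

/-- A flat of corank one. -/
structure IsCoatomFlat (M : Matroid α) (X : Set α) : Prop where
  isFlat : M.IsFlat X
  corank_one : M.eRk X + 1 = M.eRank

/-- A matroid is round if its ground set is not the union of two proper flats. -/
def IsRound (M : Matroid α) : Prop :=
  ∀ F₁ F₂, M.IsFlat F₁ → M.IsFlat F₂ → F₁ ∪ F₂ = M.E → F₁ = M.E ∨ F₂ = M.E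

/-- `M` is the modular join of `M ↾ E₁` and `M ↾ E₂` (over `E₁ ∩ E₂`). -/
structure IsModularJoin (M : Matroid α) (E₁ E₂ : Set α) : Prop where
  modular_left : IsModularFlat M E₁
  modular_right : IsModularFlat M E₂
  proper_left : E₁ ≠ M.E
  proper_right : E₂ ≠ M.E
  union_eq : E₁ ∪ E₂ = M.E

/-- The class `ME` of modularly extended simple matroids. -/
inductive ModularlyExtended : Matroid α → Prop
  | empty : ModularlyExtended (Matroid.emptyOn α)
  | modularCoatom (M : Matroid α) (X : Set α) (hM : IsSimple M) (hX : IsModularFlat M X)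
      (hX' : IsCoatomFlat M X) (h : ModularlyExtended (M ↾ X)) : ModularlyExtended M
  | modularJoin (M : Matroid α) (E₁ E₂ : Set α) (hM : IsSimple M) (hE : IsModularJoin M E₁ E₂)
      (hround : IsRound (M ↾ (E₁ ∩ E₂))) (h₁ : ModularlyExtended (M ↾ E₁))
      (h₂ : ModularlyExtended (M ↾ E₂)) : ModularlyExtended M

/-- The lattice of flats of `M`, ordered by inclusion. -/
abbrev FlatLattice (M : Matroid α) : Type _ := {F : Set α // M.IsFlat F}

/-- The least flat. -/
def botFlat (M : Matroid α) : FlatLattice M := ⟨M.closure ∅, M.isFlat_closure ∅⟩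

instance flatLattice_finite (M : Matroid α) [M.Finite] : Finite (FlatLattice M) :=
  Set.Finite.subset M.ground_finite.finite_subsets fun _ hF => hF.subset_ground

open Classical in
/-- The one-variable Möbius function of the lattice of flats. -/
noncomputable def moebius (M : Matroid α) [M.Finite] (F : FlatLattice M) : ℤ :=
  letI : Fintype (FlatLattice M) := Fintype.ofFinite _
  letI : LocallyFiniteOrder (FlatLattice M) := Fintype.toLocallyFiniteOrder
  IncidenceAlgebra.mu ℤ (botFlat M) F

/-- The characteristic polynomial `χ(M, t) = ∑ μ(F) t ^ (r(M) - r(F))`, the sum being over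
all flats `F`; the exponent is a genuine difference because `r(F) ≤ r(M) < ∞`. -/
noncomputable def charPoly (M : Matroid α) [M.Finite] : ℤ[X] :=
  letI : Fintype (FlatLattice M) := Fintype.ofFinite _
  ∑ F : FlatLattice M, C (moebius M F) * X ^ (M.eRank.toNat - (M.eRk F.1).toNat)

/-- `X₀ ⊆ ⋯ ⊆ Xₙ` is a divisional flag of `M`. -/
structure IsDivisionalFlag (M : Matroid α) [M.Finite] (n : ℕ) (X : Fin (n + 1) → Set α) :
    Prop where
  rank_eq : M.eRank = n
  first : X 0 = ∅
  last : X (Fin.last n) = M.E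
  isFlat : ∀ i, M.IsFlat (X i)
  rank_flat : ∀ i, M.eRk (X i) = (i : ℕ)
  subset : ∀ i : Fin n, X i.castSucc ⊆ X i.succ
  dvd : ∀ i : Fin n, charPoly (M ／ X i.succ) ∣ charPoly (M ／ X i.castSucc)

/-- `M` has a divisional flag. -/
def HasDivisionalFlag (M : Matroid α) [M.Finite] : Prop :=
  ∃ (n : ℕ) (X : Fin (n + 1) → Set α), IsDivisionalFlag M n X

/-- A divisional atom of `M` (an atom of a simple matroid being an element of it). -/
def IsDivisionalAtom (M : Matroid α) [M.Finite] (e : α) : Prop :=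
  e ∈ M.E ∧ charPoly (M ／ {e}) ∣ charPoly M

/-- The simplification `si(M)`: delete all loops and all but one (chosen) element of each
parallel class. The parallel class of a nonloop `e` is `cl {e}` minus the loops, and that set
is empty if `e` is a loop or not in the ground set. -/
noncomputable def si (M : Matroid α) : Matroid α :=
  M ↾ {e | ∃ h : (M.closure {e} \ M.loops).Nonempty, e = h.some}

end Matroids

section Arrangements

variable {K V : Type*} [Field K] [AddCommGroup V] [Module K V] [FiniteDimensional K V]

/-- The codimension of the intersection of a set of subspaces (`0` for the empty set). -/
noncomputable def interCodim (I : Set (Submodule K V)) : ℕ := Module.finrank K (V ⧸ sInf I)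

theorem interCodim_mono {I J : Set (Submodule K V)} (h : sInf I ≤ sInf J) :
    interCodim J ≤ interCodim I := by
  have h1 := Submodule.finrank_quotient_add_finrank (sInf I)
  have h2 := Submodule.finrank_quotient_add_finrank (sInf J)
  have h3 := Submodule.finrank_mono h
  unfold interCodim
  omega

theorem interCodim_insert_le {H : Submodule K V} (hH : Module.finrank K (V ⧸ H) = 1)
    (I : Set (Submodule K V)) : interCodim (insert H I) ≤ interCodim I + 1 := by
  have h1 := Submodule.finrank_quotient_add_finrank (sInf I)
  have h2 := Submodule.finrank_quotient_add_finrank (sInf (insert H I))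
  have h3 := Submodule.finrank_quotient_add_finrank H
  have h4 := Submodule.finrank_sup_add_finrank_inf_eq H (sInf I)
  have h5 := Submodule.finrank_le (H ⊔ sInf I)
  rw [sInf_insert] at h2
  unfold interCodim
  rw [sInf_insert]
  omega

theorem sInf_le_of_interCodim_insert {H : Submodule K V} {I : Set (Submodule K V)}
    (h : interCodim (insert H I) ≤ interCodim I) : sInf I ≤ H := by
  have h1 := Submodule.finrank_quotient_add_finrank (sInf I)
  have h2 := Submodule.finrank_quotient_add_finrank (sInf (insert H I))
  unfold interCodim at h
  rw [sInf_insert] at h h2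
  have h3 : H ⊓ sInf I = sInf I :=
    Submodule.eq_of_le_of_finrank_le inf_le_right (by omega)
  exact inf_eq_right.mp h3

/-- A central hyperplane arrangement in `V`: a finite set of subspaces of codimension one. -/
structure Arrangement (K V : Type*) [Field K] [AddCommGroup V] [Module K V] where
  hyperplanes : Set (Submodule K V)
  finite : hyperplanes.Finite
  codim_one : ∀ H ∈ hyperplanes, Module.finrank K (V ⧸ H) = 1

theorem Arrangement.interCodim_le_add (A : Arrangement K V) (I : Set (Submodule K V))
    {T : Set (Submodule K V)} (hT : T ⊆ A.hyperplanes) :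
    interCodim (I ∪ T) ≤ interCodim I + T.ncard := by
  have hfin := A.finite.subset hT
  induction T, hfin using Set.Finite.induction_on with
  | empty => simp
  | @insert a s ha hs ih =>
    rw [Set.union_insert, Set.ncard_insert_of_notMem ha hs]
    have h1 := interCodim_insert_le (A.codim_one a (hT (Set.mem_insert _ _))) (I ∪ s)
    have h2 := ih ((Set.subset_insert _ _).trans hT)
    omega

theorem interCodim_empty : interCodim (∅ : Set (Submodule K V)) = 0 := by
  have h := Submodule.finrank_quotient_add_finrank (⊤ : Submodule K V)
  have h' := finrank_top K V
  unfold interCodim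
  rw [sInf_empty]
  omega

/-- The linear dependence matroid `M(A)` on the set of hyperplanes of `A`: hyperplanes
`H₁, …, Hₙ` are independent if `H₁ ∩ ⋯ ∩ Hₙ` has codimension `n`. -/
noncomputable def Arrangement.matroid (A : Arrangement K V) : Matroid (Submodule K V) :=
  (IndepMatroid.ofFinite A.finite
    (Indep := fun I => I ⊆ A.hyperplanes ∧ interCodim I = I.ncard)
    (indep_empty := ⟨Set.empty_subset _, by rw [interCodim_empty, Set.ncard_empty]⟩)
    (indep_subset := by
      rintro I J ⟨hJ, hJc⟩ hIJ
      refine ⟨hIJ.trans hJ, ?_⟩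
      have hJf := A.finite.subset hJ
      have h1 := A.interCodim_le_add I (T := J \ I) (Set.sdiff_subset.trans hJ)
      have h2 := A.interCodim_le_add ∅ (hIJ.trans hJ)
      have h3 := Set.ncard_sdiff_add_ncard_of_subset hIJ hJf
      rw [Set.union_sdiff_cancel hIJ] at h1
      rw [Set.empty_union, interCodim_empty] at h2
      omega)
    (indep_aug := by
      rintro I J ⟨hI, hIc⟩ ⟨hJ, hJc⟩ hlt
      by_contra! hcon
      have hle : sInf I ≤ sInf J := by
        refine le_sInf fun H hH => ?_
        by_cases hHI : H ∈ I
        · exact sInf_le hHI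
        · refine sInf_le_of_interCodim_insert ?_
          have h1 := interCodim_insert_le (A.codim_one H (hJ hH)) I
          have h2 : interCodim (insert H I) ≠ (insert H I).ncard := fun h =>
            hcon H hH hHI (Set.insert_subset (hJ hH) hI) h
          rw [Set.ncard_insert_of_notMem hHI (A.finite.subset hI)] at h2
          omega
      have := interCodim_mono hle
      omega)
    (subset_ground := fun _ h => h.1)).matroid

instance Arrangement.matroid_finite (A : Arrangement K V) : A.matroid.Finite := ⟨A.finite⟩

/-- An arrangement is divisionally free if its matroid has a divisional flag. -/
def Arrangement.DivisionallyFree (A : Arrangement K V) : Prop := HasDivisionalFlag A.matroid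

end Arrangements

end ModularConstruction

open ModularConstruction

/-!
For a modular flat `Y` of `M`, the characteristic polynomial of `M ↾ Y` divides that of `M`, and the
complementary factor is a sum over the flats meeting `Y` trivially. If another flat `X` covers the
rest of the ground set and `e ∈ Y` lies outside `X`, then contracting `e` does not change this
factor, so a divisional atom `e` of `M ↾ Y` is a divisional atom of `M`.

To use this in a modular join of `M ↾ E₁` and `M ↾ E₂`, the atom of `M ↾ E₂` has to avoid the round
flat `E₁ ∩ E₂`. The induction therefore produces an atom outside every given proper round flat. This
passes to the next matroid because a round flat of a modular join is contained in `E₁` or `E₂`, and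
because intersecting a round flat with a modular coatom not containing it leaves a round flat.

After contracting an atom `e`, an element parallel to one of a modular flat `Y ∌ e` may fall outside
`Y`. This does no harm: characteristic polynomials and the class of modularly extended matroids
depend only on lattices of flats, which are unchanged by restricting to a set that meets every
parallel class. Iterating over atoms yields the flag.
-/

namespace ModularConstruction

section Moebius

open Finset IncidenceAlgebra

theorem eq_mu_bot_of_sum_Iic {P R : Type*} [Ring R] [PartialOrder P] [OrderBot P]
    [LocallyFiniteOrder P] [DecidableEq P] {g : P → R}
    (hg : ∀ z, ∑ y ≤ z, g y = if z = ⊥ then 1 else 0) (z : P) : g z = mu R ⊥ z := by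
  rw [moebius_inversion_bot g _ (fun z => (hg z).symm) z]
  simp

theorem mu_bot_apply_orderIso {P Q R : Type*} [AddCommGroup R] [One R]
    [PartialOrder P] [OrderBot P] [LocallyFiniteOrder P] [DecidableEq P]
    [PartialOrder Q] [OrderBot Q] [LocallyFiniteOrder Q] [DecidableEq Q]
    {a : P} {b : Q} (φ : Set.Iic a ≃o Set.Iic b) (c : Set.Iic a) :
    mu R (⊥ : P) c = mu R (⊥ : Q) (φ c) := by
  have : Finite (Set.Iic a) := (Set.finite_Iic a).to_subtype
  induction c using WellFoundedLT.induction with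
  | ind c ih =>
    rcases eq_or_ne c ⊥ with rfl | hc
    · simp
    have hc_ne : (⊥ : P) ≠ c := fun h => hc (Subtype.ext h.symm)
    have hφc_ne : (⊥ : Q) ≠ φ c := fun h => hc ((map_eq_bot_iff φ).1 (Subtype.ext h.symm))
    have mem_Iic {x : P} (hx : x ∈ Ico ⊥ (c : P)) : x ∈ Set.Iic a :=
      (mem_Ico.1 hx).2.le.trans c.2
    rw [mu_eq_neg_sum_Ico_of_ne hc_ne, mu_eq_neg_sum_Ico_of_ne hφc_ne, neg_inj]
    refine sum_bij (fun x hx => (φ ⟨x, mem_Iic hx⟩ : Q)) (fun x hx => ?_) (fun x hx y hy h => ?_)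
      (fun y hy => ?_) (fun x hx => ih ⟨x, mem_Iic hx⟩ (mem_Ico.1 hx).2)
    · exact mem_Ico.2 ⟨bot_le, φ.lt_iff_lt.2 (mem_Ico.1 hx).2⟩
    · simpa [Subtype.coe_inj] using h
    · have hyc : (⟨y, (mem_Ico.1 hy).2.le.trans (φ c).2⟩ : Set.Iic b) < φ c := (mem_Ico.1 hy).2
      exact ⟨φ.symm ⟨y, _⟩, mem_Ico.2 ⟨bot_le, φ.symm_apply_lt.2 hyc⟩, by simp⟩

variable {L R : Type*} [CommRing R] [Lattice L] [OrderBot L] [Fintype L] [LocallyFiniteOrder L]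
  [DecidableEq L] [DecidableLE L]

theorem sum_mu_bot_mul_mu_bot (x w : L) :
    ∑ p : L × L with (p.1 ≤ x ∧ x ⊓ p.2 = ⊥) ∧ p.1 ⊔ p.2 = w, mu R ⊥ p.1 * mu R ⊥ p.2 =
      mu R ⊥ w := by
  refine eq_mu_bot_of_sum_Iic (g := fun w => ∑ p : L × L with
    (p.1 ≤ x ∧ x ⊓ p.2 = ⊥) ∧ p.1 ⊔ p.2 = w, mu R ⊥ p.1 * mu R ⊥ p.2) (fun z => ?_) w
  have fiber_eq (w : L) (hw : w ∈ Iic z) :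
      ({p : L × L | (p.1 ≤ x ∧ x ⊓ p.2 = ⊥) ∧ p.1 ⊔ p.2 = w} : Finset (L × L)) =
        {p ∈ Iic (x ⊓ z) ×ˢ {v ∈ Iic z | x ⊓ v = ⊥} | p.1 ⊔ p.2 = w} := by
    ext p
    simp only [mem_filter, mem_univ, true_and, mem_product, mem_Iic, le_inf_iff] at hw ⊢
    refine and_congr_left fun hp => ?_
    have := sup_le_iff.1 (hp.trans_le hw)
    tauto
  have disjoint_eq : (if x ⊓ z = ⊥ then (1 : R) else 0) * ∑ v ∈ Iic z with x ⊓ v = ⊥, mu R ⊥ v =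
      if x ⊓ z = ⊥ then ∑ v ≤ z, mu R ⊥ v else 0 := by
    split_ifs with hxz
    · rw [one_mul, filter_true_of_mem]
      exact fun v hv => eq_bot_mono (inf_le_inf_left x (mem_Iic.1 hv)) hxz
    · rw [zero_mul]
  calc ∑ w ≤ z, ∑ p : L × L with (p.1 ≤ x ∧ x ⊓ p.2 = ⊥) ∧ p.1 ⊔ p.2 = w,
        mu R ⊥ p.1 * mu R ⊥ p.2
      = ∑ p ∈ Iic (x ⊓ z) ×ˢ {v ∈ Iic z | x ⊓ v = ⊥}, mu R ⊥ p.1 * mu R ⊥ p.2 := by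
        rw [sum_congr rfl fun w hw => by rw [fiber_eq w hw]]
        refine sum_fiberwise_of_maps_to (fun p hp => ?_) _
        simp only [mem_product, mem_Iic, le_inf_iff, mem_filter] at hp ⊢
        exact sup_le hp.1.2 hp.2.1
    _ = (∑ u ∈ Icc ⊥ (x ⊓ z), mu R ⊥ u) * ∑ v ∈ Iic z with x ⊓ v = ⊥, mu R ⊥ v := by
        rw [sum_mul_sum, sum_product, Icc_bot]
    _ = if z = ⊥ then 1 else 0 := by
        rw [sum_Icc_mu_right, if_congr eq_comm rfl rfl, disjoint_eq, ← Icc_bot, sum_Icc_mu_right]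
        by_cases hz : z = ⊥ <;> simp [hz, Ne.symm]

theorem sum_mu_bot_smul {A : Type*} [AddCommGroup A] [Module R A] (x : L) (f : L → A) :
    ∑ w, mu R ⊥ w • f w =
      ∑ u with u ≤ x, ∑ v with x ⊓ v = ⊥, (mu R ⊥ u * mu R ⊥ v) • f (u ⊔ v) := by
  calc ∑ w, mu R ⊥ w • f w
      = ∑ w, ∑ p : L × L with (p.1 ≤ x ∧ x ⊓ p.2 = ⊥) ∧ p.1 ⊔ p.2 = w,
          (mu R ⊥ p.1 * mu R ⊥ p.2) • f (p.1 ⊔ p.2) := by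
        refine sum_congr rfl fun w _ => ?_
        rw [← sum_mu_bot_mul_mu_bot x w, sum_smul]
        exact sum_congr rfl fun p hp => by rw [(mem_filter.1 hp).2.2]
    _ = ∑ p : L × L with p.1 ≤ x ∧ x ⊓ p.2 = ⊥, (mu R ⊥ p.1 * mu R ⊥ p.2) • f (p.1 ⊔ p.2) := by
        simp only [← filter_filter]
        exact sum_fiberwise _ _ _
    _ = _ := by
        rw [← sum_product', ← univ_product_univ, filter_product (· ≤ x) (x ⊓ · = ⊥)]

end Moebius

section Rank

variable {α : Type*} {M : Matroid α} {A B C F G R X : Set α} {e : α}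

/-- The rank of a set as a natural number; the infinite rank becomes `0`. -/
noncomputable def rk (M : Matroid α) (A : Set α) : ℕ := (M.eRk A).toNat

@[simp] theorem rk_closure (M : Matroid α) (A : Set α) : rk M (M.closure A) = rk M A := by
  rw [rk, rk, M.eRk_closure_eq]

@[simp] theorem rk_loops (M : Matroid α) : rk M M.loops = 0 := by simp [rk]

theorem rk_congr_closure (h : M.closure A = M.closure B) : rk M A = rk M B := by
  rw [← rk_closure, h, rk_closure]

theorem rk_restrict (M : Matroid α) (h : A ⊆ R) : rk (M ↾ R) A = rk M A := by
  rw [rk, rk, M.restrict_eRk_eq h]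

theorem rk_singleton (he : M.IsNonloop e) : rk M {e} = 1 := by
  rw [rk, he.eRk_eq, ENat.toNat_one]

theorem exists_isNonloop_of_rk_pos (hA : A ⊆ M.E) (h : 0 < rk M A) :
    ∃ e ∈ A, M.IsNonloop e := by
  by_contra! hc
  have : M.eRk A = 0 := (Matroid.eRk_eq_zero_iff hA).2 fun x hx =>
    Matroid.isLoop_of_not_isNonloop (hA hx) (hc x hx)
  simp [rk, this] at h

section RankFinite

variable [M.RankFinite]

theorem coe_rk (M : Matroid α) [M.RankFinite] (A : Set α) : (rk M A : ℕ∞) = M.eRk A :=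
  ENat.natCast_toNat (Matroid.eRk_ne_top_iff.2 (M.isRkFinite_set A))

theorem rk_mono (M : Matroid α) [M.RankFinite] (h : A ⊆ B) : rk M A ≤ rk M B := by
  simpa only [← coe_rk, Nat.cast_le] using M.eRk_mono h

theorem rk_inter_add_rk_union_le (M : Matroid α) [M.RankFinite] (A B : Set α) :
    rk M (A ∩ B) + rk M (A ∪ B) ≤ rk M A + rk M B := by
  have := M.eRk_inter_add_eRk_union_le A B
  simp only [← coe_rk] at this
  exact_mod_cast this

theorem rk_insert_le (M : Matroid α) [M.RankFinite] (e : α) (A : Set α) :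
    rk M (insert e A) ≤ rk M A + 1 := by
  have := M.eRk_insert_le_add_one e A
  simp only [← coe_rk] at this
  exact_mod_cast this

theorem rk_insert_of_notMem_flat (hF : M.IsFlat F) (he : e ∈ M.E) (heF : e ∉ F) :
    rk M (insert e F) = rk M F + 1 := by
  have := Matroid.eRk_insert_eq_add_one (M := M) (X := F) ⟨he, by rwa [hF.closure]⟩
  simp only [← coe_rk] at this
  exact_mod_cast this

theorem closure_eq_of_rk_le (hAB : A ⊆ B) (h : rk M B ≤ rk M A) :
    M.closure A = M.closure B := by
  refine (M.isRkFinite_set A).closure_eq_closure_of_subset_of_eRk_ge_eRk hAB ?_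
  rw [← coe_rk, ← coe_rk]
  exact_mod_cast h

theorem eq_of_rk_le (hF : M.IsFlat F) (hFA : F ⊆ A) (hA : A ⊆ M.E) (h : rk M A ≤ rk M F) :
    F = A := by
  refine hFA.antisymm ((M.subset_closure A hA).trans ?_)
  rw [← closure_eq_of_rk_le hFA h, hF.closure]

theorem rk_contract (M : Matroid α) [M.RankFinite] (C A : Set α) :
    rk (M ／ C) A + rk M C = rk M (A ∪ C) := by
  obtain ⟨J, hJ⟩ := M.exists_isBasis' C
  obtain ⟨I, hI, hJI⟩ :=
    hJ.indep.subset_isBasis'_of_subset (hJ.subset.trans Set.subset_union_right : J ⊆ A ∪ C)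
  have hIC : I ∩ C = J := (hJ.eq_of_subset_indep (hI.indep.inter_right C)
    (Set.subset_inter hJI hJ.subset) Set.inter_subset_right).symm
  have hbasis : (M ／ C).IsBasis' (I \ C) ((A ∪ C) \ C) :=
    hI.contract_isBasis' hJ (by rw [← hIC, Set.sdiff_union_inter]; exact hI.indep)
  have hground : (A ∪ C) \ C ∩ (M ／ C).E = A ∩ (M ／ C).E := by
    rw [Matroid.contract_ground]; grind
  have heRk : (M ／ C).eRk A + M.eRk C = M.eRk (A ∪ C) := by
    rw [← Matroid.eRk_inter_ground, ← hground, Matroid.eRk_inter_ground,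
      hbasis.eRk_eq_encard, hJ.eRk_eq_encard, hI.eRk_eq_encard, ← hIC,
      Set.encard_sdiff_add_encard_inter]
  simp only [← coe_rk] at heRk
  exact_mod_cast heRk

end RankFinite

theorem isFlat_inter (hF : M.IsFlat F) (hG : M.IsFlat G) : M.IsFlat (F ∩ G) := by
  rw [Set.inter_eq_iInter]
  exact Matroid.IsFlat.iInter fun b => by cases b <;> assumption

theorem closure_subset_flat (hF : M.IsFlat F) (h : A ⊆ F) : M.closure A ⊆ F :=
  (M.closure_subset_closure h).trans hF.closure.subset

theorem isFlat_restrict_iff (hR : R ⊆ M.E) :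
    (M ↾ R).IsFlat F ↔ F ⊆ R ∧ M.closure F ∩ R = F := by
  rw [Matroid.isFlat_iff_closure_eq]
  constructor
  · intro h
    have hF : F ⊆ R := h ▸ (M ↾ R).closure_subset_ground F
    rw [M.restrict_closure_eq hF hR] at h
    exact ⟨hF, h⟩
  · rintro ⟨hF, h⟩
    rw [M.restrict_closure_eq hF hR, h]

theorem isFlat_restrict_flat_iff (hX : M.IsFlat X) :
    (M ↾ X).IsFlat F ↔ M.IsFlat F ∧ F ⊆ X := by
  rw [isFlat_restrict_iff hX.subset_ground, Matroid.isFlat_iff_closure_eq, and_comm]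
  refine and_congr_left fun hFX => ?_
  rw [Set.inter_eq_left.2 (closure_subset_flat hX hFX)]

theorem isFlat_inter_restrict (hR : R ⊆ M.E) (hF : M.IsFlat F) : (M ↾ R).IsFlat (F ∩ R) := by
  refine (isFlat_restrict_iff hR).2 ⟨Set.inter_subset_right, Set.Subset.antisymm ?_ ?_⟩
  · exact Set.inter_subset_inter_left R (closure_subset_flat hF Set.inter_subset_left)
  · exact Set.subset_inter (M.subset_closure _ (Set.inter_subset_right.trans hR))
      Set.inter_subset_right

theorem isFlat_contract_iff (hC : C ⊆ M.E) :
    (M ／ C).IsFlat F ↔ Disjoint F C ∧ M.IsFlat (F ∪ C) := by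
  have hC_cl : C ⊆ M.closure (F ∪ C) := M.subset_closure_of_subset' Set.subset_union_right
  rw [Matroid.isFlat_iff_closure_eq, M.contract_closure_eq, Matroid.isFlat_iff_closure_eq]
  constructor
  · intro h
    refine ⟨?_, ?_⟩
    · rw [← h]
      exact Set.disjoint_sdiff_left
    · rw [← Set.sdiff_union_of_subset hC_cl, h]
  · rintro ⟨hdisj, h⟩
    rw [h, Set.union_sdiff_right, hdisj.sdiff_eq_left]

theorem isFlat_contractElem_iff (he : e ∈ M.E) :
    (M ／ {e}).IsFlat F ↔ e ∉ F ∧ M.IsFlat (insert e F) := by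
  rw [isFlat_contract_iff (Set.singleton_subset_iff.2 he), Set.disjoint_singleton_right,
    Set.union_singleton]

theorem rk_contractElem [M.RankFinite] (he : M.IsNonloop e) (A : Set α) :
    rk (M ／ {e}) A + 1 = rk M (insert e A) := by
  rw [← rk_singleton he, rk_contract, Set.union_singleton]

end Rank

section Modular

variable {α : Type*} {M : Matroid α} {F U X Y : Set α}

theorem isModularFlat_iff [M.RankFinite] :
    IsModularFlat M X ↔ M.IsFlat X ∧
      ∀ Y, M.IsFlat Y → rk M X + rk M Y = rk M (X ∩ Y) + rk M (X ∪ Y) := by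
  have cast_iff Y : M.eRk X + M.eRk Y = M.eRk (X ∩ Y) + M.eRk (M.closure (X ∪ Y)) ↔
      rk M X + rk M Y = rk M (X ∩ Y) + rk M (X ∪ Y) := by
    rw [M.eRk_closure_eq]
    simp only [← coe_rk]
    norm_cast
  exact ⟨fun h => ⟨h.1, fun Y hY => (cast_iff Y).1 (h.2 Y hY)⟩,
    fun h => ⟨h.1, fun Y hY => (cast_iff Y).2 (h.2 Y hY)⟩⟩

theorem isCoatomFlat_iff [M.RankFinite] :
    IsCoatomFlat M X ↔ M.IsFlat X ∧ rk M X + 1 = rk M M.E := by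
  have cast_iff : M.eRk X + 1 = M.eRank ↔ rk M X + 1 = rk M M.E := by
    rw [M.eRank_def]
    simp only [← coe_rk]
    norm_cast
  exact ⟨fun h => ⟨h.1, cast_iff.1 h.2⟩, fun h => ⟨h.1, cast_iff.2 h.2⟩⟩

theorem IsModularFlat.rk_add_rk [M.RankFinite] (hX : IsModularFlat M X) (hY : M.IsFlat Y) :
    rk M X + rk M Y = rk M (X ∩ Y) + rk M (X ∪ Y) :=
  (isModularFlat_iff.1 hX).2 Y hY

theorem IsModularFlat.rk_add_rk_of_subset [M.RankFinite] (hY : IsModularFlat M Y)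
    (hF : M.IsFlat F) (hUY : U ⊆ Y) (hFU : F ∩ Y ⊆ U) :
    rk M U + rk M F = rk M (F ∩ Y) + rk M (U ∪ F) := by
  have hFY := hY.rk_add_rk hF
  have hjoin := hY.rk_add_rk (M.isFlat_closure (U ∪ F))
  rw [rk_closure, rk_congr_closure (by simp : M.closure (Y ∪ M.closure (U ∪ F)) =
    M.closure (Y ∪ (U ∪ F))), ← Set.union_assoc, Set.union_eq_left.2 hUY] at hjoin
  have hU : rk M U ≤ rk M (Y ∩ M.closure (U ∪ F)) :=
    rk_mono M (Set.subset_inter hUY (M.subset_closure_of_subset' Set.subset_union_left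
      (hUY.trans hY.isFlat.subset_ground)))
  have hsub := rk_inter_add_rk_union_le M U F
  have hUF : rk M (F ∩ Y) ≤ rk M (U ∩ F) :=
    rk_mono M fun x hx => ⟨hFU hx, hx.1⟩
  rw [Set.inter_comm] at hFY
  omega

theorem IsModularFlat.inter_restrict [M.RankFinite] (hY : IsModularFlat M Y) (hX : M.IsFlat X) :
    IsModularFlat (M ↾ X) (X ∩ Y) := by
  refine isModularFlat_iff.2 ⟨(isFlat_restrict_flat_iff hX).2
    ⟨isFlat_inter hX hY.isFlat, Set.inter_subset_left⟩, fun Z hZ => ?_⟩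
  obtain ⟨hZ_flat, hZX⟩ := (isFlat_restrict_flat_iff hX).1 hZ
  have hinter : X ∩ Y ∩ Z = Z ∩ Y := by grind
  rw [rk_restrict M Set.inter_subset_left, rk_restrict M hZX,
    rk_restrict M (Set.inter_subset_right.trans hZX),
    rk_restrict M (Set.union_subset Set.inter_subset_left hZX), hinter]
  exact hY.rk_add_rk_of_subset hZ_flat Set.inter_subset_right
    (Set.inter_subset_inter_left Y hZX)

end Modular

section Simple

variable {α : Type*} {M : Matroid α} {X : Set α} {e f : α}

theorem IsSimple.isNonloop (hM : IsSimple M) (he : e ∈ M.E) : M.IsNonloop e := by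
  have := hM.indep_pair e he e he
  rwa [Set.pair_eq_singleton, Matroid.indep_singleton] at this

theorem IsSimple.loops_eq (hM : IsSimple M) : M.loops = ∅ :=
  Set.eq_empty_of_forall_notMem fun _ hx =>
    Matroid.IsLoop.not_isNonloop hx (hM.isNonloop (M.loops_subset_ground hx))

theorem IsSimple.isFlat_empty (hM : IsSimple M) : M.IsFlat ∅ :=
  hM.loops_eq ▸ M.isFlat_closure ∅

theorem IsSimple.isFlat_singleton (hM : IsSimple M) (he : e ∈ M.E) : M.IsFlat {e} := by
  refine Matroid.isFlat_iff_closure_eq.2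
    (Set.Subset.antisymm (fun x hx => ?_) (M.subset_closure {e} (by simpa)))
  have hxE := M.closure_subset_ground _ hx
  by_contra hne
  exact ((hM.isNonloop he).indep.notMem_closure_iff_of_notMem hne hxE).2
    (hM.indep_pair x hxE e he) hx

theorem IsSimple.restrict (hM : IsSimple M) (hX : X ⊆ M.E) : IsSimple (M ↾ X) where
  finite := Matroid.restrict_finite (hM.finite.ground_finite.subset hX)
  indep_pair e he f hf := Matroid.restrict_indep_iff.2
    ⟨hM.indep_pair e (hX he) f (hX hf), Set.pair_subset he hf⟩

end Simple

section CharPoly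

variable {α β : Type*} {M N : Matroid α} {F X : Set α}

instance flatLatticeLattice (M : Matroid α) : Lattice (FlatLattice M) where
  sup F G := ⟨M.closure (F ∪ G), M.isFlat_closure _⟩
  le_sup_left F _ := M.subset_closure_of_subset' Set.subset_union_left F.2.subset_ground
  le_sup_right _ G := M.subset_closure_of_subset' Set.subset_union_right G.2.subset_ground
  sup_le _ _ H hF hG := closure_subset_flat H.2 (Set.union_subset hF hG)
  inf F G := ⟨F ∩ G, isFlat_inter F.2 G.2⟩
  inf_le_left _ _ := Set.inter_subset_left
  inf_le_right _ _ := Set.inter_subset_right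
  le_inf _ _ _ := Set.subset_inter

instance flatLatticeBoundedOrder (M : Matroid α) : BoundedOrder (FlatLattice M) where
  bot := botFlat M
  bot_le F := F.2.loops_subset
  top := ⟨M.E, M.ground_isFlat⟩
  le_top F := F.2.subset_ground

noncomputable instance flatLatticeFintype (M : Matroid α) [M.Finite] : Fintype (FlatLattice M) :=
  Fintype.ofFinite _

open Classical in
noncomputable instance flatLatticeLocallyFiniteOrder (M : Matroid α) [M.Finite] :
    LocallyFiniteOrder (FlatLattice M) :=
  Fintype.toLocallyFiniteOrder

open Classical in
theorem moebius_eq_mu_bot (M : Matroid α) [M.Finite] (F : FlatLattice M) :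
    moebius M F = IncidenceAlgebra.mu ℤ ⊥ F :=
  rfl

theorem charPoly_eq_sum (M : Matroid α) [M.Finite] :
    charPoly M = ∑ F : FlatLattice M,
      moebius M F • (Polynomial.X ^ (rk M M.E - rk M F) : ℤ[X]) := by
  simp only [charPoly, rk, M.eRk_ground, smul_eq_C_mul]

theorem moebius_congr {M : Matroid α} {N : Matroid β} [M.Finite] [N.Finite] {F : FlatLattice M}
    {G : FlatLattice N} (φ : Set.Iic F ≃o Set.Iic G) : moebius M F = moebius N G := by
  classical
  have hφ : (φ ⊤ : FlatLattice N) = G := by rw [map_top]; rfl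
  have := mu_bot_apply_orderIso (R := ℤ) φ ⊤
  rwa [hφ] at this

theorem moebius_congr_of_isFlat_iff [M.Finite] [N.Finite] (hM : M.IsFlat F) (hN : N.IsFlat F)
    (h : ∀ G ⊆ F, M.IsFlat G ↔ N.IsFlat G) : moebius M ⟨F, hM⟩ = moebius N ⟨F, hN⟩ :=
  moebius_congr
    { toFun := fun G => ⟨⟨G, (h G G.2).1 G.1.2⟩, G.2⟩
      invFun := fun G => ⟨⟨G, (h G G.2).2 G.1.2⟩, G.2⟩
      left_inv := fun _ => rfl
      right_inv := fun _ => rfl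
      map_rel_iff' := Iff.rfl }

theorem charPoly_congr {M : Matroid α} {N : Matroid β} [M.Finite] [N.Finite]
    (φ : FlatLattice M ≃o FlatLattice N) (hrk : ∀ F, rk N (φ F) = rk M F) :
    charPoly M = charPoly N := by
  have hground : rk N N.E = rk M M.E := by
    have := hrk ⊤
    rwa [map_top] at this
  rw [charPoly_eq_sum, charPoly_eq_sum]
  refine Fintype.sum_equiv φ.toEquiv _ _ fun F => ?_
  have hF : moebius M F = moebius N (φ F) := moebius_congr (OrderIso.Iic φ F)
  rw [hF, hground, ← hrk F]
  rfl

open Classical in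
/-- The complementary factor of `χ(M ↾ X)` in `χ(M)` for a modular flat `X`: the part of the sum
defining `χ(M)` that runs over the flats meeting `X` in loops, normalized by `r(X)`. -/
noncomputable def complPoly (M : Matroid α) [M.Finite] (X : Set α) : ℤ[X] :=
  ∑ F : FlatLattice M with X ∩ F.1 ⊆ M.loops,
    moebius M F • (Polynomial.X ^ (rk M M.E - rk M X - rk M F) : ℤ[X])

open Classical in
theorem charPoly_restrict_eq_sum [M.Finite] [(M ↾ X).Finite] (hX : M.IsFlat X) :
    charPoly (M ↾ X) = ∑ F : FlatLattice M with F.1 ⊆ X,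
      moebius M F • (Polynomial.X ^ (rk M X - rk M F) : ℤ[X]) := by
  rw [charPoly_eq_sum]
  refine Finset.sum_bij' (fun F _ => ⟨F, ((isFlat_restrict_flat_iff hX).1 F.2).1⟩)
    (fun F hF => ⟨F, (isFlat_restrict_flat_iff hX).2 ⟨F.2, (Finset.mem_filter.1 hF).2⟩⟩)
    (fun F _ => ?_) (fun _ _ => Finset.mem_univ _) (fun _ _ => rfl) (fun _ _ => rfl)
    (fun F _ => ?_)
  · exact Finset.mem_filter.2 ⟨Finset.mem_univ _, F.2.subset_ground⟩
  · have hF := (isFlat_restrict_flat_iff hX).1 F.2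
    rw [Matroid.restrict_ground_eq, rk_restrict M subset_rfl, rk_restrict M hF.2]
    congr 1
    exact moebius_congr_of_isFlat_iff F.2 hF.1 fun G hG => by
      rw [isFlat_restrict_flat_iff hX, and_iff_left (hG.trans hF.2)]

theorem IsModularFlat.charPoly_eq_mul [M.Finite] [(M ↾ X).Finite] (hX : IsModularFlat M X) :
    charPoly M = charPoly (M ↾ X) * complPoly M X := by
  classical
  rw [charPoly_eq_sum M, charPoly_restrict_eq_sum hX.isFlat, complPoly, Finset.sum_mul_sum]
  simp only [moebius_eq_mu_bot]
  have inf_eq_bot_iff (G : FlatLattice M) :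
      ⟨X, hX.isFlat⟩ ⊓ G = (⊥ : FlatLattice M) ↔ X ∩ G ⊆ M.loops := by
    rw [eq_bot_iff]; rfl
  rw [sum_mu_bot_smul (⟨X, hX.isFlat⟩ : FlatLattice M)]
  refine Finset.sum_congr (Finset.filter_congr fun _ _ => Iff.rfl) fun F hF =>
    Finset.sum_congr (Finset.filter_congr fun G _ => inf_eq_bot_iff G) fun G hG => ?_
  have hFX : F.1 ⊆ X := (Finset.mem_filter.1 hF).2
  have hGX : G.1 ∩ X ⊆ M.loops := Set.inter_comm X G.1 ▸ (Finset.mem_filter.1 hG).2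
  have hGX_rk : rk M (G.1 ∩ X) = 0 :=
    Nat.eq_zero_of_le_zero ((rk_mono M hGX).trans_eq (rk_loops M))
  have hsup_rk : rk M (F ⊔ G).1 = rk M F + rk M G := by
    have := hX.rk_add_rk_of_subset G.2 hFX (hGX.trans F.2.loops_subset)
    rw [show rk M (F ⊔ G).1 = rk M (F.1 ∪ G.1) from rk_closure M _]
    omega
  have hexp : rk M M.E - rk M (F ⊔ G).1 = rk M X - rk M F + (rk M M.E - rk M X - rk M G) := by
    have := rk_mono M hFX
    have := rk_mono M (Set.union_subset hX.isFlat.subset_ground G.2.subset_ground)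
    have := hX.rk_add_rk_of_subset G.2 subset_rfl (hGX.trans hX.isFlat.loops_subset)
    omega
  rw [hexp, pow_add, smul_mul_smul_comm]

end CharPoly

section ParallelDense

variable {α : Type*} {N : Matroid α} {F G S X : Set α} {e f : α}

/-- `S` meets every parallel class of nonloops of `N`, so that `N ↾ S` has the same lattice of
flats as `N`. The simplifications of `N` are the simple restrictions of `N` to such sets. -/
structure IsParallelDense (N : Matroid α) (S : Set α) : Prop where
  subset_ground : S ⊆ N.E
  exists_closure_eq : ∀ e, N.IsNonloop e → ∃ s ∈ S, N.closure {s} = N.closure {e}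

namespace IsParallelDense

theorem exists_mem_inter (hS : IsParallelDense N S) (hF : N.IsFlat F) (heF : e ∈ F)
    (he : N.IsNonloop e) : ∃ s ∈ F ∩ S, N.closure {s} = N.closure {e} := by
  obtain ⟨s, hs, hse⟩ := hS.exists_closure_eq e he
  have hsF : N.closure {s} ⊆ F := hse ▸ closure_subset_flat hF (Set.singleton_subset_iff.2 heF)
  exact ⟨s, ⟨hsF (N.mem_closure_self s (hS.subset_ground hs)), hs⟩, hse⟩

theorem closure_inter (hS : IsParallelDense N S) (hF : N.IsFlat F) : N.closure (F ∩ S) = F := by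
  refine (closure_subset_flat hF Set.inter_subset_left).antisymm fun e he => ?_
  by_cases hloop : N.IsLoop e
  · exact N.closure_subset_closure (Set.empty_subset _) hloop
  have hnonloop := Matroid.isNonloop_of_not_isLoop (hF.subset_ground he) hloop
  obtain ⟨s, hs, hse⟩ := hS.exists_mem_inter hF he hnonloop
  exact N.closure_subset_closure (Set.singleton_subset_iff.2 hs)
    (hse ▸ N.mem_closure_self e hnonloop.mem_ground)

theorem rk_inter (hS : IsParallelDense N S) (hF : N.IsFlat F) : rk N (F ∩ S) = rk N F := by
  rw [← rk_closure, hS.closure_inter hF]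

theorem rk_inter_union_inter (hS : IsParallelDense N S) (hF : N.IsFlat F) (hG : N.IsFlat G) :
    rk N (F ∩ S ∪ G ∩ S) = rk N (F ∪ G) := by
  refine rk_congr_closure ?_
  rw [← N.closure_closure_union_closure_eq_closure_union, hS.closure_inter hF,
    hS.closure_inter hG]

theorem rk_self (hS : IsParallelDense N S) : rk N S = rk N N.E := by
  rw [← hS.rk_inter N.ground_isFlat, Set.inter_eq_right.2 hS.subset_ground]

theorem restrict_flat (hS : IsParallelDense N S) (hF : N.IsFlat F) :
    IsParallelDense (N ↾ F) (F ∩ S) where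
  subset_ground := Set.inter_subset_left
  exists_closure_eq e he := by
    rw [Matroid.restrict_isNonloop_iff] at he
    obtain ⟨s, hs, hse⟩ := hS.exists_mem_inter hF he.2 he.1
    refine ⟨s, hs, ?_⟩
    rw [N.restrict_closure_eq (Set.singleton_subset_iff.2 hs.1) hF.subset_ground,
      N.restrict_closure_eq (Set.singleton_subset_iff.2 he.2) hF.subset_ground, hse]

theorem inter_union_inter_eq_iff (hS : IsParallelDense N S) (hF : N.IsFlat F)
    (hG : N.IsFlat G) : F ∩ S ∪ G ∩ S = S ↔ F ∪ G = N.E := by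
  rw [← Set.union_inter_distrib_right, Set.inter_eq_right]
  refine ⟨fun hSFG => (Set.union_subset hF.subset_ground hG.subset_ground).antisymm fun e he => ?_,
    fun h => h ▸ hS.subset_ground⟩
  by_cases hloop : N.IsLoop e
  · exact Or.inl (hF.loops_subset hloop)
  obtain ⟨s, hs, hse⟩ := hS.exists_closure_eq e (Matroid.isNonloop_of_not_isLoop he hloop)
  have he_closure : e ∈ N.closure {s} := hse ▸ N.mem_closure_self e he
  exact (hSFG hs).imp (fun h => closure_subset_flat hF (Set.singleton_subset_iff.2 h) he_closure)
    (fun h => closure_subset_flat hG (Set.singleton_subset_iff.2 h) he_closure)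

theorem inter_eq_self_iff (hS : IsParallelDense N S) (hF : N.IsFlat F) :
    F ∩ S = S ↔ F = N.E := by
  simpa only [Set.union_self] using hS.inter_union_inter_eq_iff hF hF

theorem isFlat_restrict_iff_exists (hS : IsParallelDense N S) :
    (N ↾ S).IsFlat X ↔ ∃ F, N.IsFlat F ∧ F ∩ S = X := by
  constructor
  · exact fun hX => ⟨_, N.isFlat_closure X, ((isFlat_restrict_iff hS.subset_ground).1 hX).2⟩
  · rintro ⟨F, hF, rfl⟩
    exact isFlat_inter_restrict hS.subset_ground hF

theorem isRound_restrict_iff (hS : IsParallelDense N S) : IsRound (N ↾ S) ↔ IsRound N := by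
  constructor
  · intro hround F G hF hG hFG
    exact (hround _ _ (isFlat_inter_restrict hS.subset_ground hF)
      (isFlat_inter_restrict hS.subset_ground hG)
      ((hS.inter_union_inter_eq_iff hF hG).2 hFG)).imp (hS.inter_eq_self_iff hF).1
      (hS.inter_eq_self_iff hG).1
  · intro hround X Y hX hY hXY
    obtain ⟨F, hF, rfl⟩ := hS.isFlat_restrict_iff_exists.1 hX
    obtain ⟨G, hG, rfl⟩ := hS.isFlat_restrict_iff_exists.1 hY
    exact (hround F G hF hG ((hS.inter_union_inter_eq_iff hF hG).1 hXY)).imp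
      (hS.inter_eq_self_iff hF).2 (hS.inter_eq_self_iff hG).2

theorem isModularFlat_inter_iff [N.RankFinite] (hS : IsParallelDense N S) (hF : N.IsFlat F) :
    IsModularFlat (N ↾ S) (F ∩ S) ↔ IsModularFlat N F := by
  have modular_iff {G : Set α} (hG : N.IsFlat G) :
      rk (N ↾ S) (F ∩ S) + rk (N ↾ S) (G ∩ S) =
        rk (N ↾ S) (F ∩ S ∩ (G ∩ S)) + rk (N ↾ S) (F ∩ S ∪ G ∩ S) ↔
      rk N F + rk N G = rk N (F ∩ G) + rk N (F ∪ G) := by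
    rw [← Set.inter_inter_distrib_right, rk_restrict N Set.inter_subset_right,
      rk_restrict N Set.inter_subset_right, rk_restrict N Set.inter_subset_right,
      rk_restrict N (Set.union_subset Set.inter_subset_right Set.inter_subset_right),
      hS.rk_inter hF, hS.rk_inter hG, hS.rk_inter (isFlat_inter hF hG),
      hS.rk_inter_union_inter hF hG]
  rw [isModularFlat_iff, isModularFlat_iff]
  refine and_congr (iff_of_true (isFlat_inter_restrict hS.subset_ground hF) hF)
    ⟨fun h G hG => (modular_iff hG).1 (h _ (isFlat_inter_restrict hS.subset_ground hG)),
      fun h Y hY => ?_⟩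
  obtain ⟨G, hG, rfl⟩ := hS.isFlat_restrict_iff_exists.1 hY
  exact (modular_iff hG).2 (h G hG)

theorem isCoatomFlat_inter_iff [N.RankFinite] (hS : IsParallelDense N S) (hF : N.IsFlat F) :
    IsCoatomFlat (N ↾ S) (F ∩ S) ↔ IsCoatomFlat N F := by
  rw [isCoatomFlat_iff, isCoatomFlat_iff, and_iff_right hF,
    and_iff_right (isFlat_inter_restrict hS.subset_ground hF), Matroid.restrict_ground_eq,
    rk_restrict N Set.inter_subset_right, rk_restrict N subset_rfl, hS.rk_inter hF, hS.rk_self]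

theorem isModularJoin_inter_iff [N.RankFinite] (hS : IsParallelDense N S) (hF : N.IsFlat F)
    (hG : N.IsFlat G) : IsModularJoin (N ↾ S) (F ∩ S) (G ∩ S) ↔ IsModularJoin N F G := by
  constructor
  · rintro ⟨hFm, hGm, hF_ne, hG_ne, hFG⟩
    exact ⟨(hS.isModularFlat_inter_iff hF).1 hFm, (hS.isModularFlat_inter_iff hG).1 hGm,
      mt (hS.inter_eq_self_iff hF).2 hF_ne, mt (hS.inter_eq_self_iff hG).2 hG_ne,
      (hS.inter_union_inter_eq_iff hF hG).1 hFG⟩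
  · rintro ⟨hFm, hGm, hF_ne, hG_ne, hFG⟩
    exact ⟨(hS.isModularFlat_inter_iff hF).2 hFm, (hS.isModularFlat_inter_iff hG).2 hGm,
      mt (hS.inter_eq_self_iff hF).1 hF_ne, mt (hS.inter_eq_self_iff hG).1 hG_ne,
      (hS.inter_union_inter_eq_iff hF hG).2 hFG⟩

theorem charPoly_restrict [N.Finite] [(N ↾ S).Finite] (hS : IsParallelDense N S) :
    charPoly (N ↾ S) = charPoly N := by
  let flatIso : FlatLattice N ≃o FlatLattice (N ↾ S) :=
    { toFun := fun F => ⟨F ∩ S, isFlat_inter_restrict hS.subset_ground F.2⟩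
      invFun := fun X => ⟨N.closure X, N.isFlat_closure X⟩
      left_inv := fun F => Subtype.ext (hS.closure_inter F.2)
      right_inv := fun X => Subtype.ext ((isFlat_restrict_iff hS.subset_ground).1 X.2).2
      map_rel_iff' := fun {F G} => ⟨fun h => by
        have hcl : N.closure (F ∩ S) ⊆ N.closure (G ∩ S) := N.closure_subset_closure h
        rwa [hS.closure_inter F.2, hS.closure_inter G.2] at hcl,
        Set.inter_subset_inter_left S⟩ }
  refine (charPoly_congr flatIso fun F => ?_).symm
  rw [← hS.rk_inter F.2]
  exact rk_restrict N Set.inter_subset_right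

end IsParallelDense

theorem isNonloop_of_mem_si_ground (he : e ∈ (si N).E) : N.IsNonloop e := by
  obtain ⟨hne, he_some⟩ := he
  have he_mem := hne.some_mem
  rw [← he_some] at he_mem
  exact Matroid.isNonloop_iff_mem_compl_loops.2
    ⟨N.closure_subset_ground _ he_mem.1, he_mem.2⟩

theorem si_ground_subset (N : Matroid α) : (si N).E ⊆ N.E := fun _ he =>
  (isNonloop_of_mem_si_ground he).mem_ground

theorem eq_of_mem_si_ground (he : e ∈ (si N).E) (hf : f ∈ (si N).E)
    (hef : N.closure {e} = N.closure {f}) : e = f := by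
  obtain ⟨hne, he_some⟩ := he
  obtain ⟨hnf, hf_some⟩ := hf
  rw [he_some, hf_some]
  congr 1
  rw [hef]

theorem isParallelDense_si_ground (N : Matroid α) : IsParallelDense N (si N).E where
  subset_ground := si_ground_subset N
  exists_closure_eq e he := by
    have hne : (N.closure {e} \ N.loops).Nonempty :=
      ⟨e, N.mem_closure_self e he.mem_ground, he.not_isLoop⟩
    have hcl : N.closure {hne.some} = N.closure {e} :=
      Matroid.IsNonloop.closure_eq_of_mem_closure (Matroid.isNonloop_iff_mem_compl_loops.2
        ⟨N.closure_subset_ground _ hne.some_mem.1, hne.some_mem.2⟩) hne.some_mem.1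
    refine ⟨hne.some, ⟨by rwa [hcl], ?_⟩, hcl⟩
    congr 1
    rw [hcl]

theorem isSimple_si (N : Matroid α) [N.Finite] : IsSimple (si N) where
  finite := Matroid.restrict_finite (N.ground_finite.subset (si_ground_subset N))
  indep_pair e he f hf := by
    refine Matroid.restrict_indep_iff.2 ⟨?_, Set.pair_subset he hf⟩
    have he_nonloop := isNonloop_of_mem_si_ground he
    have hf_nonloop := isNonloop_of_mem_si_ground hf
    rcases eq_or_ne e f with rfl | hne
    · simpa using he_nonloop
    rw [← hf_nonloop.indep.notMem_closure_iff_of_notMem hne he_nonloop.mem_ground]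
    exact fun he_cl => hne (eq_of_mem_si_ground he hf (he_nonloop.closure_eq_of_mem_closure he_cl))

end ParallelDense

section Simplification

variable {α : Type*} {M N : Matroid α} {E₁ E₂ F S T X : Set α}

theorem ModularlyExtended.isSimple (h : ModularlyExtended M) : IsSimple M := by
  cases h with
  | empty => exact ⟨⟨Set.finite_empty⟩, fun _ he => absurd he (Set.notMem_empty _)⟩
  | modularCoatom _ _ hM => exact hM
  | modularJoin _ _ _ hM => exact hM

theorem restrict_restrict_inter (N : Matroid α) (F S : Set α) :
    (N ↾ F) ↾ (F ∩ S) = (N ↾ S) ↾ (F ∩ S) := by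
  rw [N.restrict_restrict_eq Set.inter_subset_left, N.restrict_restrict_eq Set.inter_subset_right]

theorem ModularlyExtended.restrict_of_isParallelDense [N.RankFinite]
    (h : ModularlyExtended (N ↾ T)) (hT : IsParallelDense N T) (hS : IsParallelDense N S)
    (hsimple : IsSimple (N ↾ S)) : ModularlyExtended (N ↾ S) := by
  have isSimple_inter {N : Matroid α} {S : Set α} (hsimple : IsSimple (N ↾ S)) (F : Set α) :
      IsSimple ((N ↾ F) ↾ (F ∩ S)) := by
    rw [restrict_restrict_inter]
    exact hsimple.restrict Set.inter_subset_right
  generalize hNT : N ↾ T = M at h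
  induction h generalizing N T S with
  | empty =>
    obtain rfl : T = ∅ := congrArg Matroid.E hNT
    have hS_empty : S = ∅ := Set.eq_empty_of_forall_notMem fun s hs => by
      obtain ⟨t, ht, -⟩ := hT.exists_closure_eq s
        (Matroid.restrict_isNonloop_iff.1 (hsimple.isNonloop hs)).1
      exact ht
    rw [hS_empty, Matroid.restrict_empty]
    exact .empty
  | modularCoatom M X hM hX hX_coatom h ih =>
    subst hNT
    obtain ⟨F, hF, rfl⟩ := hT.isFlat_restrict_iff_exists.1 hX.isFlat
    refine .modularCoatom _ (F ∩ S) hsimple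
      ((hS.isModularFlat_inter_iff hF).2 ((hT.isModularFlat_inter_iff hF).1 hX))
      ((hS.isCoatomFlat_inter_iff hF).2 ((hT.isCoatomFlat_inter_iff hF).1 hX_coatom)) ?_
    rw [← restrict_restrict_inter]
    exact ih (hT.restrict_flat hF) (hS.restrict_flat hF) (isSimple_inter hsimple F)
      (restrict_restrict_inter N F T)
  | modularJoin M E₁ E₂ hM hjoin hround h₁ h₂ ih₁ ih₂ =>
    subst hNT
    obtain ⟨F, hF, rfl⟩ := hT.isFlat_restrict_iff_exists.1 hjoin.modular_left.isFlat
    obtain ⟨G, hG, rfl⟩ := hT.isFlat_restrict_iff_exists.1 hjoin.modular_right.isFlat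
    have hFG := isFlat_inter hF hG
    refine .modularJoin _ (F ∩ S) (G ∩ S) hsimple
      ((hS.isModularJoin_inter_iff hF hG).2 ((hT.isModularJoin_inter_iff hF hG).1 hjoin)) ?_ ?_ ?_
    · rw [← Set.inter_inter_distrib_right, ← restrict_restrict_inter,
        (hT.restrict_flat hFG).isRound_restrict_iff] at hround
      rwa [← Set.inter_inter_distrib_right, ← restrict_restrict_inter,
        (hS.restrict_flat hFG).isRound_restrict_iff]
    · rw [← restrict_restrict_inter]
      exact ih₁ (hT.restrict_flat hF) (hS.restrict_flat hF) (isSimple_inter hsimple F)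
        (restrict_restrict_inter N F T)
    · rw [← restrict_restrict_inter]
      exact ih₂ (hT.restrict_flat hG) (hS.restrict_flat hG) (isSimple_inter hsimple G)
        (restrict_restrict_inter N G T)

theorem si_eq_restrict (N : Matroid α) : si N = N ↾ (si N).E := rfl

theorem ModularlyExtended.si_of_isParallelDense [N.Finite] (h : ModularlyExtended (N ↾ S))
    (hS : IsParallelDense N S) : ModularlyExtended (si N) :=
  h.restrict_of_isParallelDense hS (isParallelDense_si_ground N) (isSimple_si N)

theorem ModularlyExtended.si_restrict_inter [N.Finite] (h : ModularlyExtended (si (N ↾ F)))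
    (hF : N.IsFlat F) : ModularlyExtended (si N ↾ (F ∩ (si N).E)) := by
  rw [si_eq_restrict, Matroid.restrict_ground_eq, ← restrict_restrict_inter]
  refine h.restrict_of_isParallelDense (isParallelDense_si_ground _)
    ((isParallelDense_si_ground N).restrict_flat hF) ?_
  rw [restrict_restrict_inter]
  exact (isSimple_si N).restrict Set.inter_subset_right

theorem ModularlyExtended.si_of_modularCoatom [N.Finite] (hX : IsModularFlat N X)
    (hX_coatom : IsCoatomFlat N X) (h : ModularlyExtended (si (N ↾ X))) :
    ModularlyExtended (si N) := by
  have hS := isParallelDense_si_ground N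
  exact .modularCoatom _ _ (isSimple_si N) ((hS.isModularFlat_inter_iff hX.isFlat).2 hX)
    ((hS.isCoatomFlat_inter_iff hX.isFlat).2 hX_coatom) (h.si_restrict_inter hX.isFlat)

theorem ModularlyExtended.si_of_modularJoin [N.Finite] (hjoin : IsModularJoin N E₁ E₂)
    (hround : IsRound (N ↾ (E₁ ∩ E₂))) (h₁ : ModularlyExtended (si (N ↾ E₁)))
    (h₂ : ModularlyExtended (si (N ↾ E₂))) : ModularlyExtended (si N) := by
  have hS := isParallelDense_si_ground N
  have hF₁ := hjoin.modular_left.isFlat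
  have hF₂ := hjoin.modular_right.isFlat
  refine .modularJoin _ _ _ (isSimple_si N) ((hS.isModularJoin_inter_iff hF₁ hF₂).2 hjoin)
    ?_ (h₁.si_restrict_inter hF₁) (h₂.si_restrict_inter hF₂)
  rwa [si_eq_restrict, Matroid.restrict_ground_eq, ← Set.inter_inter_distrib_right,
    ← restrict_restrict_inter,
    (hS.restrict_flat (isFlat_inter hF₁ hF₂)).isRound_restrict_iff]

end Simplification

section Contraction

variable {α : Type*} {M : Matroid α} {X Y : Set α} {e : α}

theorem closure_contractElem_of_mem (hX : M.IsFlat X) (he : e ∈ X) :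
    (M ／ {e}).closure X = X \ {e} := by
  rw [M.contract_closure_eq, Set.union_singleton, Set.insert_eq_of_mem he, hX.closure]

theorem contractElem_restrict_of_notMem (hY : M.IsFlat Y) (he : e ∈ M.E) (heY : e ∉ Y) :
    (M ／ {e}) ↾ Y = M ↾ Y := by
  have hnonloop : M.IsNonloop e :=
    Matroid.isNonloop_of_not_isLoop he fun hloop => heY (hY.loops_subset hloop)
  refine Matroid.ext_indep rfl fun I (hI : I ⊆ Y) => ?_
  have heI : e ∉ M.closure I := fun h => heY (closure_subset_flat hY hI h)
  rw [Matroid.restrict_indep_iff, Matroid.restrict_indep_iff, hnonloop.contractElem_indep_iff,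
    Matroid.insert_indep_iff]
  grind

theorem rk_contractElem_sdiff [M.RankFinite] (he : M.IsNonloop e) (heX : e ∈ X) :
    rk (M ／ {e}) (X \ {e}) + 1 = rk M X := by
  rw [rk_contractElem he, Set.insert_sdiff_singleton, Set.insert_eq_of_mem heX]

theorem IsModularFlat.closure_contractElem [M.RankFinite] (hX : IsModularFlat M X)
    (he : M.IsNonloop e) : IsModularFlat (M ／ {e}) ((M ／ {e}).closure X) := by
  refine isModularFlat_iff.2 ⟨Matroid.isFlat_closure _, fun F hF => ?_⟩
  have hG := ((isFlat_contractElem_iff he.mem_ground).1 hF).2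
  have hunion : rk (M ／ {e}) ((M ／ {e}).closure X ∪ F) = rk (M ／ {e}) (X ∪ F) :=
    rk_congr_closure (Matroid.closure_union_closure_left_eq _ _ _)
  have hinter : insert e (X ∩ insert e F) ⊆ insert e ((M ／ {e}).closure X ∩ F) := by
    have hX_sub : X ⊆ M.closure (X ∪ {e}) :=
      M.subset_closure_of_subset' Set.subset_union_left hX.isFlat.subset_ground
    rw [M.contract_closure_eq]
    grind
  have hinter_rk := rk_mono M hinter
  have hX_F := hX.rk_add_rk hG
  have hsub := rk_inter_add_rk_union_le M X (insert e (X ∩ insert e F))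
  rw [Set.union_insert, Set.union_eq_left.2 (Set.inter_subset_left : X ∩ insert e F ⊆ X)] at hsub
  have hsub_inter := rk_mono M
    (Set.subset_inter Set.inter_subset_left (Set.subset_insert e _) :
      X ∩ insert e F ⊆ X ∩ insert e (X ∩ insert e F))
  have hsub_contract := rk_inter_add_rk_union_le (M ／ {e}) ((M ／ {e}).closure X) F
  have hrk_X := rk_contractElem he X
  have hrk_F := rk_contractElem he F
  have hrk_inter := rk_contractElem he ((M ／ {e}).closure X ∩ F)
  have hrk_union := rk_contractElem he (X ∪ F)
  rw [← Set.union_insert] at hrk_union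
  rw [hunion, rk_closure] at hsub_contract ⊢
  omega

theorem IsCoatomFlat.contractElem [M.RankFinite] (hX : IsCoatomFlat M X) (he : M.IsNonloop e)
    (heX : e ∈ X) : IsCoatomFlat (M ／ {e}) (X \ {e}) := by
  refine isCoatomFlat_iff.2 ⟨?_, ?_⟩
  · rw [← closure_contractElem_of_mem hX.isFlat heX]
    exact Matroid.isFlat_closure _
  · rw [rk_contractElem_sdiff he heX, Matroid.contract_ground]
    have := (isCoatomFlat_iff.1 hX).2
    have := rk_contractElem_sdiff he he.mem_ground
    omega

theorem IsModularFlat.isParallelDense_contractElem [M.RankFinite] (hY : IsModularFlat M Y)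
    (he : M.IsNonloop e) (heY : e ∉ Y) :
    IsParallelDense ((M ／ {e}) ↾ (M ／ {e}).closure Y) Y where
  subset_ground :=
    (M ／ {e}).subset_closure Y (Set.subset_sdiff_singleton hY.isFlat.subset_ground heY)
  exists_closure_eq f hf := by
    have hY_sub : Y ⊆ (M ／ {e}).closure Y :=
      (M ／ {e}).subset_closure Y (Set.subset_sdiff_singleton hY.isFlat.subset_ground heY)
    obtain ⟨hf_nonloop, hfY⟩ := Matroid.restrict_isNonloop_iff.1 hf
    -- The line through `e` and `f` meets `Y`, because it raises the rank of `Y` by only one.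
    have hline_rk : rk M {e, f} = 2 := by
      rw [← rk_contractElem he, rk_singleton hf_nonloop]
    have hline_sub : Y ∪ M.closure {e, f} ⊆ M.closure (Y ∪ {e}) := by
      refine Set.union_subset
        (M.subset_closure_of_subset' Set.subset_union_left hY.isFlat.subset_ground)
        (closure_subset_flat (M.isFlat_closure _) (Set.pair_subset ?_ ?_))
      · exact M.mem_closure_of_mem' (Or.inr rfl) he.mem_ground
      · rw [M.contract_closure_eq] at hfY
        exact hfY.1
    have hline_inter : 0 < rk M (Y ∩ M.closure {e, f}) := by
      have := hY.rk_add_rk (M.isFlat_closure {e, f})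
      have := rk_mono M hline_sub
      have := rk_insert_le M e Y
      simp only [rk_closure, Set.union_singleton] at *
      omega
    obtain ⟨y, ⟨hyY, hy_line⟩, hy⟩ := exists_isNonloop_of_rk_pos
      (Set.inter_subset_left.trans hY.isFlat.subset_ground) hline_inter
    have hy_contract : (M ／ {e}).IsNonloop y := by
      refine Matroid.contract_isNonloop_iff.2 ⟨hy.mem_ground, fun hye => heY ?_⟩
      refine closure_subset_flat hY.isFlat (Set.singleton_subset_iff.2 hyY) ?_
      rw [hy.closure_eq_of_mem_closure hye]
      exact M.mem_closure_self e he.mem_ground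
    have hyf : y ∈ (M ／ {e}).closure {f} := by
      rw [M.contract_closure_eq, Set.union_singleton]
      exact ⟨hy_line, fun h => heY (h ▸ hyY)⟩
    refine ⟨y, hyY, ?_⟩
    rw [Matroid.restrict_closure_eq _ (Set.singleton_subset_iff.2 (hY_sub hyY))
        (Matroid.closure_subset_ground _ _),
      Matroid.restrict_closure_eq _ (Set.singleton_subset_iff.2 hfY)
        (Matroid.closure_subset_ground _ _), hy_contract.closure_eq_of_mem_closure hyf]

theorem IsModularFlat.isParallelDense_contractElem_of_isCoatomFlat [M.RankFinite]
    (hY : IsModularFlat M Y) (hY_coatom : IsCoatomFlat M Y) (he : M.IsNonloop e) (heY : e ∉ Y) :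
    IsParallelDense (M ／ {e}) Y := by
  have hspan : (M ／ {e}).closure Y = (M ／ {e}).E := by
    rw [M.contract_closure_eq, Set.union_singleton, Matroid.contract_ground, ← M.closure_ground]
    congr 1
    refine closure_eq_of_rk_le (Set.insert_subset he.mem_ground hY.isFlat.subset_ground) ?_
    rw [rk_insert_of_notMem_flat hY.isFlat he.mem_ground heY, (isCoatomFlat_iff.1 hY_coatom).2]
  simpa only [hspan, Matroid.restrict_ground_eq_self] using
    hY.isParallelDense_contractElem he heY

theorem IsRound.contractElem (hM : IsRound M) (he : e ∈ M.E) : IsRound (M ／ {e}) := by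
  intro F G hF hG hFG
  rw [isFlat_contractElem_iff he] at hF hG
  have hcover : insert e F ∪ insert e G = M.E := by
    rw [← Set.insert_union_distrib, hFG, Matroid.contract_ground, Set.insert_sdiff_singleton,
      Set.insert_eq_of_mem he]
  refine (hM _ _ hF.2 hG.2 hcover).imp (fun h => ?_) fun h => ?_
  · rw [Matroid.contract_ground, ← h, Set.insert_sdiff_self_of_notMem hF.1]
  · rw [Matroid.contract_ground, ← h, Set.insert_sdiff_self_of_notMem hG.1]

theorem IsRound.restrict_of_isModularFlat_of_isCoatomFlat [M.RankFinite] (hM : IsRound M)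
    (hY : IsModularFlat M Y) (hY_coatom : IsCoatomFlat M Y) : IsRound (M ↾ Y) := by
  have hY_ne : Y ≠ M.E := by
    rintro rfl
    exact (Nat.succ_ne_self _) (isCoatomFlat_iff.1 hY_coatom).2
  obtain ⟨e, he, heY⟩ := Set.exists_of_ssubset (hY.isFlat.subset_ground.ssubset_of_ne hY_ne)
  have he_nonloop : M.IsNonloop e :=
    Matroid.isNonloop_of_not_isLoop he fun hloop => heY (hY.isFlat.loops_subset hloop)
  rw [← contractElem_restrict_of_notMem hY.isFlat he heY,
    (hY.isParallelDense_contractElem_of_isCoatomFlat hY_coatom he_nonloop heY).isRound_restrict_iff]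
  exact hM.contractElem he

theorem IsModularFlat.isCoatomFlat_inter_restrict [M.RankFinite] (hY : IsModularFlat M Y)
    (hY_coatom : IsCoatomFlat M Y) (hX : M.IsFlat X) (hXY : ¬X ⊆ Y) :
    IsCoatomFlat (M ↾ X) (X ∩ Y) := by
  refine isCoatomFlat_iff.2 ⟨(isFlat_restrict_flat_iff hX).2
    ⟨isFlat_inter hX hY.isFlat, Set.inter_subset_left⟩, ?_⟩
  rw [rk_restrict M Set.inter_subset_left, Matroid.restrict_ground_eq, rk_restrict M subset_rfl,
    Set.inter_comm]
  obtain ⟨e, heX, heY⟩ := Set.not_subset.1 hXY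
  have hinsert := rk_insert_of_notMem_flat hY.isFlat (hX.subset_ground heX) heY
  have hinsert_le := rk_mono M
    (Set.insert_subset (Or.inr heX) Set.subset_union_left : insert e Y ⊆ Y ∪ X)
  have hunion_le := rk_mono M (Set.union_subset hY.isFlat.subset_ground hX.subset_ground)
  have hmodular := hY.rk_add_rk hX
  have hcorank := (isCoatomFlat_iff.1 hY_coatom).2
  omega

theorem IsRound.restrict_inter_of_isModularFlat_of_isCoatomFlat [M.RankFinite]
    (hround : IsRound (M ↾ X)) (hX : M.IsFlat X) (hY : IsModularFlat M Y)
    (hY_coatom : IsCoatomFlat M Y) (hXY : ¬X ⊆ Y) : IsRound (M ↾ (X ∩ Y)) := by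
  rw [← M.restrict_restrict_eq Set.inter_subset_left]
  exact hround.restrict_of_isModularFlat_of_isCoatomFlat (hY.inter_restrict hX)
    (hY.isCoatomFlat_inter_restrict hY_coatom hX hXY)

end Contraction

section ComplementaryFactor

variable {α : Type*} {M : Matroid α} {F X Y : Set α} {e : α}

theorem IsModularFlat.isFlat_insert_of_disjoint [M.RankFinite] (hY : IsModularFlat M Y)
    (hM : IsSimple M) (hX : M.IsFlat X) (hXY : X ∪ Y = M.E) (heY : e ∈ Y) (heX : e ∉ X)
    (hF : M.IsFlat F) (hFY : Disjoint F Y) : M.IsFlat (insert e F) := by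
  have he := hY.isFlat.subset_ground heY
  have heF : e ∉ F := fun h => Set.disjoint_left.1 hFY h heY
  set K := M.closure (insert e F)
  have hK : M.IsFlat K := M.isFlat_closure _
  have heK : e ∈ K := M.mem_closure_of_mem' (Set.mem_insert e F) he
  have hFK : F ⊆ K := M.subset_closure_of_subset' (Set.subset_insert e F) hF.subset_ground
  have hK_rk : rk M K = rk M F + 1 := by
    rw [rk_closure, rk_insert_of_notMem_flat hF he heF]
  have hKX : F = K ∩ X := by
    refine eq_of_rk_le hF (Set.subset_inter hFK fun x hx => ?_)
      (Set.inter_subset_left.trans hK.subset_ground) ?_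
    · exact (hXY.superset (hF.subset_ground hx)).resolve_right (Set.disjoint_left.1 hFY hx)
    · by_contra! hlt
      have hKX_eq := eq_of_rk_le (isFlat_inter hK hX) Set.inter_subset_left hK.subset_ground
        (by omega)
      exact heX (hKX_eq.superset heK).2
  have hKY : {e} = K ∩ Y := by
    refine eq_of_rk_le (hM.isFlat_singleton he) (Set.singleton_subset_iff.2 ⟨heK, heY⟩)
      (Set.inter_subset_left.trans hK.subset_ground) ?_
    have hK_modular := hY.rk_add_rk hK
    have hF_modular := hY.rk_add_rk hF
    have hYF_rk : rk M (Y ∩ F) = 0 := by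
      rw [Set.inter_comm, hFY.inter_eq, ← hM.loops_eq, rk_loops]
    have hunion := rk_mono M (Set.union_subset_union_right Y hFK)
    rw [rk_singleton (hM.isNonloop he), Set.inter_comm]
    omega
  have hK_eq : insert e F = K := by
    rw [Set.insert_eq, hKY, hKX, ← Set.inter_union_distrib_left, Set.union_comm, hXY,
      Set.inter_eq_left.2 hK.subset_ground]
  rwa [hK_eq]

theorem IsModularFlat.isFlat_contractElem_iff_of_disjoint [M.RankFinite] (hY : IsModularFlat M Y)
    (hM : IsSimple M) (hX : M.IsFlat X) (hXY : X ∪ Y = M.E) (heY : e ∈ Y) (heX : e ∉ X)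
    (hFY : Disjoint F Y) : (M ／ {e}).IsFlat F ↔ M.IsFlat F := by
  have heF : e ∉ F := fun h => Set.disjoint_left.1 hFY h heY
  rw [isFlat_contractElem_iff (hY.isFlat.subset_ground heY), and_iff_right heF]
  refine ⟨fun hF => ?_, fun hF => hY.isFlat_insert_of_disjoint hM hX hXY heY heX hF hFY⟩
  have hFX : F ⊆ X := fun x hx =>
    (hXY.superset (hF.subset_ground (Or.inr hx))).resolve_right (Set.disjoint_left.1 hFY hx)
  have hF_eq : F = insert e F ∩ X := by
    rw [Set.insert_inter_of_notMem heX, Set.inter_eq_left.2 hFX]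
  rw [hF_eq]
  exact isFlat_inter hF hX

theorem IsSimple.inter_subset_loops_iff (hM : IsSimple M) :
    Y ∩ F ⊆ M.loops ↔ Disjoint F Y := by
  rw [hM.loops_eq, Set.subset_empty_iff, ← Set.disjoint_iff_inter_eq_empty, disjoint_comm]

theorem IsSimple.inter_subset_loops_contractElem_iff (hM : IsSimple M) (he : e ∈ M.E)
    (heF : e ∉ F) : Y \ {e} ∩ F ⊆ (M ／ {e}).loops ↔ Disjoint F Y := by
  rw [Matroid.contract_loops_eq, (hM.isFlat_singleton he).closure, sdiff_self,
    Set.bot_eq_empty, Set.subset_empty_iff, ← Set.disjoint_iff_inter_eq_empty,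
    Set.disjoint_left, Set.disjoint_right]
  grind

theorem IsModularFlat.complPoly_contractElem [M.Finite] (hY : IsModularFlat M Y)
    (hM : IsSimple M) (hX : M.IsFlat X) (hXY : X ∪ Y = M.E) (heY : e ∈ Y) (heX : e ∉ X) :
    complPoly (M ／ {e}) (Y \ {e}) = complPoly M Y := by
  classical
  have he := hY.isFlat.subset_ground heY
  have he_nonloop := hM.isNonloop he
  have isFlat_iff {F : Set α} (hFY : Disjoint F Y) : (M ／ {e}).IsFlat F ↔ M.IsFlat F :=
    hY.isFlat_contractElem_iff_of_disjoint hM hX hXY heY heX hFY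
  have mem_iff (F : FlatLattice (M ／ {e})) :
      Y \ {e} ∩ F.1 ⊆ (M ／ {e}).loops ↔ Disjoint F.1 Y :=
    hM.inter_subset_loops_contractElem_iff he ((isFlat_contractElem_iff he).1 F.2).1
  simp only [complPoly, hM.inter_subset_loops_iff, mem_iff]
  refine Finset.sum_bij' (fun F hF => ⟨F, (isFlat_iff (Finset.mem_filter.1 hF).2).1 F.2⟩)
    (fun F hF => ⟨F, (isFlat_iff (Finset.mem_filter.1 hF).2).2 F.2⟩) (fun F hF => ?_)
    (fun F hF => ?_) (fun _ _ => rfl) (fun _ _ => rfl) (fun F hF => ?_)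
  · exact Finset.mem_filter.2 ⟨Finset.mem_univ _, (Finset.mem_filter.1 hF).2⟩
  · exact Finset.mem_filter.2 ⟨Finset.mem_univ _, (Finset.mem_filter.1 hF).2⟩
  have hFY : Disjoint F.1 Y := (Finset.mem_filter.1 hF).2
  have hmoebius : moebius (M ／ {e}) F = moebius M ⟨F, (isFlat_iff hFY).1 F.2⟩ :=
    moebius_congr_of_isFlat_iff F.2 _ fun G hG => isFlat_iff (hFY.mono_left hG)
  have hF_rk := rk_contractElem he_nonloop F
  rw [rk_insert_of_notMem_flat ((isFlat_iff hFY).1 F.2) he fun h =>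
    Set.disjoint_left.1 hFY h heY] at hF_rk
  have hY_rk := rk_contractElem_sdiff he_nonloop heY
  have hE_rk := rk_contractElem_sdiff he_nonloop he
  rw [hmoebius, Matroid.contract_ground]
  congr 2
  dsimp only
  omega

theorem IsModularFlat.charPoly_contractElem_dvd [M.Finite] [(M ↾ Y).Finite]
    (hY : IsModularFlat M Y) (hM : IsSimple M) (hX : M.IsFlat X) (hXY : X ∪ Y = M.E)
    (heY : e ∈ Y) (heX : e ∉ X) (h : charPoly ((M ↾ Y) ／ {e}) ∣ charPoly (M ↾ Y)) :
    charPoly (M ／ {e}) ∣ charPoly M := by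
  have he := hY.isFlat.subset_ground heY
  have hY_contract : IsModularFlat (M ／ {e}) (Y \ {e}) :=
    closure_contractElem_of_mem hY.isFlat heY ▸ hY.closure_contractElem (hM.isNonloop he)
  have hrestrict := M.restrict_contract_eq_contract_restrict (Set.singleton_subset_iff.2 heY)
  have : ((M ／ {e}) ↾ (Y \ {e})).Finite := hrestrict ▸ inferInstance
  simp only [hrestrict] at h
  rw [hY.charPoly_eq_mul, hY_contract.charPoly_eq_mul,
    hY.complPoly_contractElem hM hX hXY heY heX]
  exact mul_dvd_mul_right h _

end ComplementaryFactor

section InductiveAtom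

variable {α : Type*} {M : Matroid α} {E₁ E₂ X Y : Set α} {e : α}

/-- A divisional atom `e` such that the simplification of `M ／ {e}` is modularly extended, so
that an induction over modularly extended matroids can continue with `M ／ {e}`. -/
structure IsInductiveAtom (M : Matroid α) [M.Finite] (e : α) : Prop where
  isDivisionalAtom : IsDivisionalAtom M e
  modularlyExtended_si : ModularlyExtended (si (M ／ {e}))

theorem IsModularFlat.isInductiveAtom_of_notMem [M.Finite] (hY : IsModularFlat M Y)
    (hY_coatom : IsCoatomFlat M Y) (he : M.IsNonloop e) (heY : e ∉ Y)
    (h : ModularlyExtended (M ↾ Y)) : IsInductiveAtom M e := by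
  have hY_dense := hY.isParallelDense_contractElem_of_isCoatomFlat hY_coatom he heY
  have hrestrict := contractElem_restrict_of_notMem hY.isFlat he.mem_ground heY
  have : (M ↾ Y).Finite := h.isSimple.finite
  have : ((M ／ {e}) ↾ Y).Finite := hrestrict ▸ this
  refine ⟨⟨he.mem_ground, ?_⟩, (hrestrict ▸ h).si_of_isParallelDense hY_dense⟩
  rw [← hY_dense.charPoly_restrict, hY.charPoly_eq_mul]
  simp only [hrestrict]
  exact dvd_mul_right _ _

theorem IsInductiveAtom.of_restrict_modularCoatom [M.Finite] [(M ↾ Y).Finite]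
    (h : IsInductiveAtom (M ↾ Y) e) (hM : IsSimple M) (hY : IsModularFlat M Y)
    (hY_coatom : IsCoatomFlat M Y) (hX : M.IsFlat X) (hXY : X ∪ Y = M.E) (heX : e ∉ X) :
    IsInductiveAtom M e := by
  have heY : e ∈ Y := h.isDivisionalAtom.1
  have he := hM.isNonloop (hY.isFlat.subset_ground heY)
  refine ⟨⟨he.mem_ground, hY.charPoly_contractElem_dvd hM hX hXY heY heX h.isDivisionalAtom.2⟩,
    .si_of_modularCoatom ?_ (hY_coatom.contractElem he heY) ?_⟩
  · exact closure_contractElem_of_mem hY.isFlat heY ▸ hY.closure_contractElem he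
  · rw [← M.restrict_contract_eq_contract_restrict (Set.singleton_subset_iff.2 heY)]
    exact h.modularlyExtended_si

theorem IsModularJoin.symm (h : IsModularJoin M E₁ E₂) : IsModularJoin M E₂ E₁ where
  modular_left := h.modular_right
  modular_right := h.modular_left
  proper_left := h.proper_right
  proper_right := h.proper_left
  union_eq := Set.union_comm E₂ E₁ ▸ h.union_eq

theorem IsModularJoin.contractElem [M.RankFinite] (h : IsModularJoin M E₁ E₂)
    (he : M.IsNonloop e) (he₁ : e ∉ E₁) (he₂ : e ∈ E₂)
    (hproper : (M ／ {e}).closure E₁ ≠ (M ／ {e}).E) :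
    IsModularJoin (M ／ {e}) ((M ／ {e}).closure E₁) (E₂ \ {e}) where
  modular_left := h.modular_left.closure_contractElem he
  modular_right := closure_contractElem_of_mem h.modular_right.isFlat he₂ ▸
    h.modular_right.closure_contractElem he
  proper_left := hproper
  proper_right hE₂ := h.proper_right <| by
    rw [← Set.insert_sdiff_self_of_mem he₂, hE₂, Matroid.contract_ground,
      Set.insert_sdiff_self_of_mem he.mem_ground]
  union_eq := by
    have hE₁ : E₁ ⊆ (M ／ {e}).closure E₁ := (M ／ {e}).subset_closure E₁
      (Set.subset_sdiff_singleton h.modular_left.isFlat.subset_ground he₁)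
    have hE₂ : E₂ \ {e} ⊆ (M ／ {e}).E :=
      Set.sdiff_subset_sdiff_left h.modular_right.isFlat.subset_ground
    refine (Set.union_subset (Matroid.closure_subset_ground _ _) hE₂).antisymm fun f hf => ?_
    exact (h.union_eq.superset hf.1).imp (fun hf₁ => hE₁ hf₁) fun hf₂ => ⟨hf₂, hf.2⟩

theorem IsModularFlat.isRound_contractElem_restrict_iff [M.RankFinite] (hX : IsModularFlat M X)
    (hY : M.IsFlat Y) (he : M.IsNonloop e) (heX : e ∉ X) (heY : e ∈ Y) :
    IsRound ((M ／ {e}) ↾ ((M ／ {e}).closure X ∩ (Y \ {e}))) ↔ IsRound (M ↾ (X ∩ Y)) := by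
  set N := M ／ {e}
  set K := N.closure X
  have hX_sub : X ⊆ K :=
    N.subset_closure X (Set.subset_sdiff_singleton hX.isFlat.subset_ground heX)
  have hK : N.IsFlat K := N.isFlat_closure X
  have hY_contract : N.IsFlat (Y \ {e}) :=
    closure_contractElem_of_mem hY heY ▸ N.isFlat_closure Y
  have hinter : K ∩ (Y \ {e}) ∩ X = X ∩ Y := by grind
  have hdense := (hX.isParallelDense_contractElem he heX).restrict_flat
    ((isFlat_restrict_flat_iff hK).2 ⟨isFlat_inter hK hY_contract, Set.inter_subset_left⟩)
  rw [hinter, N.restrict_restrict_eq Set.inter_subset_left] at hdense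
  rw [← hdense.isRound_restrict_iff,
    N.restrict_restrict_eq (Set.subset_inter (Set.inter_subset_left.trans hX_sub) ?_),
    contractElem_restrict_of_notMem (isFlat_inter hX.isFlat hY) he.mem_ground fun h => heX h.1]
  exact Set.subset_sdiff_singleton Set.inter_subset_right fun h => heX h.1

theorem IsModularFlat.modularlyExtended_si_contractElem_restrict [M.Finite]
    (hX : IsModularFlat M X) (he : M.IsNonloop e) (heX : e ∉ X) (h : ModularlyExtended (M ↾ X)) :
    ModularlyExtended (si ((M ／ {e}) ↾ (M ／ {e}).closure X)) := by
  have hdense := hX.isParallelDense_contractElem he heX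
  have : ((M ／ {e}) ↾ (M ／ {e}).closure X).Finite :=
    Matroid.restrict_finite ((M ／ {e}).ground_finite.subset (Matroid.closure_subset_ground _ _))
  refine ModularlyExtended.si_of_isParallelDense ?_ hdense
  have hX_sub : X ⊆ (M ／ {e}).closure X := hdense.subset_ground
  rwa [(M ／ {e}).restrict_restrict_eq hX_sub,
    contractElem_restrict_of_notMem hX.isFlat he.mem_ground heX]

theorem IsInductiveAtom.of_restrict_modularJoin [M.Finite] [(M ↾ E₂).Finite]
    (h : IsInductiveAtom (M ↾ E₂) e) (hM : IsSimple M) (hjoin : IsModularJoin M E₁ E₂)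
    (hround : IsRound (M ↾ (E₁ ∩ E₂))) (h₁ : ModularlyExtended (M ↾ E₁)) (he₁ : e ∉ E₁) :
    IsInductiveAtom M e := by
  have hE₁ := hjoin.modular_left
  have hE₂ := hjoin.modular_right
  have he₂ : e ∈ E₂ := h.isDivisionalAtom.1
  have he := hM.isNonloop (hE₂.isFlat.subset_ground he₂)
  refine ⟨⟨he.mem_ground, hE₂.charPoly_contractElem_dvd hM hE₁.isFlat hjoin.union_eq he₂ he₁
    h.isDivisionalAtom.2⟩, ?_⟩
  have h₁_contract := hE₁.modularlyExtended_si_contractElem_restrict he he₁ h₁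
  by_cases hproper : (M ／ {e}).closure E₁ = (M ／ {e}).E
  · rwa [hproper, Matroid.restrict_ground_eq_self] at h₁_contract
  refine .si_of_modularJoin (hjoin.contractElem he he₁ he₂ hproper)
    ((hE₁.isRound_contractElem_restrict_iff hE₂.isFlat he he₁ he₂).2 hround) h₁_contract ?_
  rw [← M.restrict_contract_eq_contract_restrict (Set.singleton_subset_iff.2 he₂)]
  exact h.modularlyExtended_si

theorem IsModularJoin.subset_or_subset (h : IsModularJoin M E₁ E₂) (hX : M.IsFlat X)
    (hround : IsRound (M ↾ X)) : X ⊆ E₁ ∨ X ⊆ E₂ := by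
  have isFlat_inter_X {F : Set α} (hF : M.IsFlat F) : (M ↾ X).IsFlat (X ∩ F) :=
    (isFlat_restrict_flat_iff hX).2 ⟨isFlat_inter hX hF, Set.inter_subset_left⟩
  refine (hround _ _ (isFlat_inter_X h.modular_left.isFlat)
    (isFlat_inter_X h.modular_right.isFlat) ?_).imp Set.inter_eq_left.1 Set.inter_eq_left.1
  rw [← Set.inter_union_distrib_left, h.union_eq]
  exact Set.inter_eq_left.2 hX.subset_ground

/-- The induction hypothesis for modularly extended matroids: outside every proper round flat
there is an inductive atom. -/
def HasInductiveAtomsOutsideRoundFlats (M : Matroid α) [M.Finite] : Prop :=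
  ∀ X, M.IsFlat X → X ≠ M.E → IsRound (M ↾ X) → ∃ e ∉ X, IsInductiveAtom M e

theorem HasInductiveAtomsOutsideRoundFlats.of_modularCoatom [M.Finite] [(M ↾ Y).Finite]
    (ih : HasInductiveAtomsOutsideRoundFlats (M ↾ Y)) (hM : IsSimple M) (hY : IsModularFlat M Y)
    (hY_coatom : IsCoatomFlat M Y) (h : ModularlyExtended (M ↾ Y)) :
    HasInductiveAtomsOutsideRoundFlats M := by
  intro X hX hX_ne hround
  by_cases hXY : X ∪ Y = M.E
  · have hXY_not : ¬X ⊆ Y := fun hsub => by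
      rw [Set.union_eq_right.2 hsub] at hXY
      exact (Nat.succ_ne_self _) (hXY ▸ (isCoatomFlat_iff.1 hY_coatom).2)
    have hYX_not : X ∩ Y ≠ Y := fun hinter =>
      hX_ne (by rw [← hXY, Set.union_eq_left.2 (Set.inter_eq_right.1 hinter)])
    have hround_inter : IsRound ((M ↾ Y) ↾ (X ∩ Y)) := by
      rw [M.restrict_restrict_eq Set.inter_subset_right]
      exact hround.restrict_inter_of_isModularFlat_of_isCoatomFlat hX hY hY_coatom hXY_not
    obtain ⟨e, heXY, he⟩ := ih (X ∩ Y) ((isFlat_restrict_flat_iff hY.isFlat).2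
      ⟨isFlat_inter hX hY.isFlat, Set.inter_subset_right⟩) hYX_not hround_inter
    have heX : e ∉ X := fun heX => heXY ⟨heX, he.isDivisionalAtom.1⟩
    exact ⟨e, heX, he.of_restrict_modularCoatom hM hY hY_coatom hX hXY heX⟩
  · obtain ⟨e, he, heXY⟩ := Set.exists_of_ssubset
      ((Set.union_subset hX.subset_ground hY.isFlat.subset_ground).ssubset_of_ne hXY)
    exact ⟨e, fun heX => heXY (Or.inl heX),
      hY.isInductiveAtom_of_notMem hY_coatom (hM.isNonloop he) (fun heY => heXY (Or.inr heY)) h⟩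

theorem HasInductiveAtomsOutsideRoundFlats.exists_notMem_left [M.Finite] [(M ↾ E₂).Finite]
    (ih : HasInductiveAtomsOutsideRoundFlats (M ↾ E₂)) (hM : IsSimple M)
    (hjoin : IsModularJoin M E₁ E₂) (hround : IsRound (M ↾ (E₁ ∩ E₂)))
    (h₁ : ModularlyExtended (M ↾ E₁)) : ∃ e ∉ E₁, IsInductiveAtom M e := by
  have hinter_ne : E₁ ∩ E₂ ≠ E₂ := fun hinter => hjoin.proper_left (by
    rw [← hjoin.union_eq, Set.union_eq_left.2 (Set.inter_eq_right.1 hinter)])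
  obtain ⟨e, he_inter, he⟩ := ih (E₁ ∩ E₂)
    ((isFlat_restrict_flat_iff hjoin.modular_right.isFlat).2
      ⟨isFlat_inter hjoin.modular_left.isFlat hjoin.modular_right.isFlat, Set.inter_subset_right⟩)
    hinter_ne (by rwa [M.restrict_restrict_eq Set.inter_subset_right])
  have he₁ : e ∉ E₁ := fun he₁ => he_inter ⟨he₁, he.isDivisionalAtom.1⟩
  exact ⟨e, he₁, he.of_restrict_modularJoin hM hjoin hround h₁ he₁⟩

theorem ModularlyExtended.hasInductiveAtomsOutsideRoundFlats (h : ModularlyExtended M) :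
    ∀ [M.Finite], HasInductiveAtomsOutsideRoundFlats M := by
  induction h with
  | empty =>
    intro _ X hX hX_ne _
    exact absurd (Set.subset_empty_iff.1 hX.subset_ground) hX_ne
  | modularCoatom M Y hM hY hY_coatom h ih =>
    intro _
    have := h.isSimple.finite
    exact ih.of_modularCoatom hM hY hY_coatom h
  | modularJoin M E₁ E₂ hM hjoin hround h₁ h₂ ih₁ ih₂ =>
    intro _ X hX _ hX_round
    have := h₁.isSimple.finite
    have := h₂.isSimple.finite
    rcases hjoin.subset_or_subset hX hX_round with hX₁ | hX₂
    · obtain ⟨e, he₁, he⟩ := ih₂.exists_notMem_left hM hjoin hround h₁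
      exact ⟨e, fun heX => he₁ (hX₁ heX), he⟩
    · rw [Set.inter_comm] at hround
      obtain ⟨e, he₂, he⟩ := ih₁.exists_notMem_left hM hjoin.symm hround h₂
      exact ⟨e, fun heX => he₂ (hX₂ heX), he⟩

theorem ModularlyExtended.exists_isInductiveAtom [M.Finite] (h : ModularlyExtended M)
    (hne : M.E.Nonempty) : ∃ e, IsInductiveAtom M e := by
  have hround : IsRound (M ↾ ∅) := fun _ _ hF _ _ =>
    Or.inl (Set.subset_empty_iff.1 hF.subset_ground)
  obtain ⟨e, -, he⟩ :=
    h.hasInductiveAtomsOutsideRoundFlats ∅ h.isSimple.isFlat_empty hne.ne_empty.symm hround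
  exact ⟨e, he⟩

end InductiveAtom

section DivisionalFlag

variable {α : Type*} {M N : Matroid α} {S X : Set α} {e : α}

theorem IsParallelDense.contract (hS : IsParallelDense N S) (X : Set α) :
    IsParallelDense (N ／ X) (S \ X) where
  subset_ground := Set.sdiff_subset_sdiff_left hS.subset_ground
  exists_closure_eq e he := by
    obtain ⟨he_ground, heX⟩ := Matroid.contract_isNonloop_iff.1 he
    have he_nonloop : N.IsNonloop e := Matroid.isNonloop_of_not_isLoop he_ground fun hloop =>
      heX (N.closure_subset_closure (Set.empty_subset X) hloop)
    obtain ⟨s, hs, hse⟩ := hS.exists_closure_eq e he_nonloop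
    have hsX : s ∉ X := fun h => heX (N.closure_subset_closure (Set.singleton_subset_iff.2 h)
      (hse ▸ N.mem_closure_self e he_ground))
    refine ⟨s, ⟨hs, hsX⟩, ?_⟩
    rw [N.contract_closure_eq, N.contract_closure_eq,
      ← N.closure_closure_union_closure_eq_closure_union, hse,
      N.closure_closure_union_closure_eq_closure_union]

theorem isParallelDense_sdiff_loops (N : Matroid α) : IsParallelDense N (N.E \ N.loops) where
  subset_ground := Set.sdiff_subset
  exists_closure_eq e he := ⟨e, Matroid.isNonloop_iff_mem_compl_loops.1 he, rfl⟩

theorem charPoly_contract_closure [N.Finite] (X : Set α) :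
    charPoly (N ／ N.closure X) = charPoly (N ／ X) := by
  have heq : N ／ N.closure X = (N ／ X) ↾ ((N ／ X).E \ (N ／ X).loops) := by
    rw [N.contract_closure_eq_contract_delete, Matroid.delete_eq_restrict,
      Matroid.contract_loops_eq]
  have : ((N ／ X) ↾ ((N ／ X).E \ (N ／ X).loops)).Finite := heq ▸ inferInstance
  simp only [heq]
  exact (isParallelDense_sdiff_loops _).charPoly_restrict

theorem IsParallelDense.charPoly_restrict_contract [N.Finite] [(N ↾ S).Finite]
    (hS : IsParallelDense N S) (hX : X ⊆ S) :
    charPoly ((N ↾ S) ／ X) = charPoly (N ／ X) := by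
  have heq := N.restrict_contract_eq_contract_restrict hX
  have : ((N ／ X) ↾ (S \ X)).Finite := heq ▸ inferInstance
  simp only [heq]
  exact (hS.contract X).charPoly_restrict

theorem IsParallelDense.closure_insert (hS : IsParallelDense (M ／ {e}) S) (he : e ∈ M.E) :
    M.closure (insert e S) = M.E := by
  have h := congrArg (insert e) (hS.closure_inter (M ／ {e}).ground_isFlat)
  rwa [Set.inter_eq_right.2 hS.subset_ground, M.contract_closure_eq, Matroid.contract_ground,
    Set.insert_sdiff_singleton, Set.insert_sdiff_singleton, Set.insert_eq_of_mem he,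
    Set.union_singleton,
    Set.insert_eq_of_mem (M.mem_closure_of_mem' (Set.mem_insert e S) he)] at h

theorem IsDivisionalFlag.eRk_closure_insert [M.Finite] [((M ／ {e}) ↾ S).Finite] {n : ℕ}
    {X : Fin (n + 1) → Set α} (hX : IsDivisionalFlag ((M ／ {e}) ↾ S) n X) (he : M.IsNonloop e)
    (i : Fin (n + 1)) : M.eRk (M.closure (insert e (X i))) = (i.succ : ℕ) := by
  have hX_sub : X i ⊆ S := (hX.isFlat i).subset_ground
  have hXi := hX.rank_flat i
  rw [← coe_rk, Nat.cast_inj, rk_restrict _ hX_sub] at hXi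
  rw [← coe_rk, rk_closure, ← rk_contractElem he, hXi, Fin.val_succ]

theorem IsDivisionalFlag.charPoly_contract_closure_insert [M.Finite] [((M ／ {e}) ↾ S).Finite]
    {n : ℕ} {X : Fin (n + 1) → Set α} (hX : IsDivisionalFlag ((M ／ {e}) ↾ S) n X)
    (hS : IsParallelDense (M ／ {e}) S) (i : Fin (n + 1)) :
    charPoly (M ／ M.closure (insert e (X i))) = charPoly (((M ／ {e}) ↾ S) ／ X i) := by
  rw [hS.charPoly_restrict_contract (hX.isFlat i).subset_ground, charPoly_contract_closure]
  simp only [Matroid.contract_contract, Set.singleton_union]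

theorem IsDivisionalFlag.cons_closure_insert [M.Finite] [((M ／ {e}) ↾ S).Finite] {n : ℕ}
    {X : Fin (n + 1) → Set α} (hX : IsDivisionalFlag ((M ／ {e}) ↾ S) n X) (hM : IsSimple M)
    (he : IsDivisionalAtom M e) (hS : IsParallelDense (M ／ {e}) S) :
    IsDivisionalFlag M (n + 1) (Fin.cons ∅ fun i => M.closure (insert e (X i))) where
  rank_eq := by
    rw [M.eRank_def, ← hS.closure_insert he.1,
      ← Matroid.restrict_ground_eq (M := M ／ {e}) (R := S), ← hX.last,
      hX.eRk_closure_insert (hM.isNonloop he.1), Fin.succ_last, Fin.val_last]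
  first := rfl
  last := by
    rw [← Fin.succ_last, Fin.cons_succ, hX.last, Matroid.restrict_ground_eq,
      hS.closure_insert he.1]
  isFlat := Fin.cases hM.isFlat_empty fun i => M.isFlat_closure (insert e (X i))
  rank_flat := Fin.cases M.eRk_empty (hX.eRk_closure_insert (hM.isNonloop he.1))
  subset := Fin.cases (Set.empty_subset _) fun i =>
    M.closure_subset_closure (Set.insert_subset_insert (hX.subset i))
  dvd := by
    refine Fin.cases ?_ fun i => ?_
    · simp only [Fin.cons_succ, Fin.castSucc_zero, Fin.cons_zero, hX.first,
        insert_empty_eq, (hM.isFlat_singleton he.1).closure, M.contract_empty]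
      exact he.2
    · rw [← Fin.succ_castSucc, Fin.cons_succ, Fin.cons_succ,
        hX.charPoly_contract_closure_insert hS, hX.charPoly_contract_closure_insert hS]
      exact hX.dvd i

theorem isDivisionalFlag_const_empty [M.Finite] (hM : M.E = ∅) :
    IsDivisionalFlag M 0 fun _ => ∅ where
  rank_eq := by rw [M.eRank_def, hM, M.eRk_empty, Nat.cast_zero]
  first := rfl
  last := hM.symm
  isFlat _ := hM ▸ M.ground_isFlat
  rank_flat i := by rw [M.eRk_empty, Fin.val_eq_zero, Nat.cast_zero]
  subset i := i.elim0
  dvd i := i.elim0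

theorem ModularlyExtended.hasDivisionalFlag [M.Finite] (h : ModularlyExtended M) :
    HasDivisionalFlag M := by
  induction hn : M.E.ncard using Nat.strong_induction_on generalizing M with
  | _ n ih =>
    rcases M.E.eq_empty_or_nonempty with hempty | hne
    · exact ⟨0, _, isDivisionalFlag_const_empty hempty⟩
    obtain ⟨e, he⟩ := h.exists_isInductiveAtom hne
    have hS := isParallelDense_si_ground (M ／ {e})
    have h_si : ModularlyExtended ((M ／ {e}) ↾ (si (M ／ {e})).E) := he.modularlyExtended_si
    have := h_si.isSimple.finite
    have hcard : (si (M ／ {e})).E.ncard < n := by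
      rw [← hn]
      exact Set.ncard_lt_ncard (hS.subset_ground.trans_ssubset
        (Set.sdiff_singleton_ssubset.2 he.isDivisionalAtom.1)) M.ground_finite
    obtain ⟨m, X, hX⟩ := ih _ hcard h_si rfl
    exact ⟨m + 1, _, hX.cons_closure_insert h.isSimple he.isDivisionalAtom hS⟩

end DivisionalFlag

end ModularConstruction

theorem mainTheorem1 :
    (∀ {α : Type*} (M : Matroid α) [M.Finite], ModularlyExtended M → HasDivisionalFlag M) ∧
    (∀ {K V : Type*} [Field K] [AddCommGroup V] [Module K V] [FiniteDimensional K V]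
        (A : Arrangement K V), ModularlyExtended A.matroid → A.DivisionallyFree) ∧
    (∀ {α : Type*} (M : Matroid α) [M.Finite], ModularlyExtended M → M.E.Nonempty →
      ∃ e, IsDivisionalAtom M e ∧ ModularlyExtended (si (M ／ {e}))) := by
  refine ⟨fun M _ h => h.hasDivisionalFlag, fun A h => h.hasDivisionalFlag, fun M _ h hne => ?_⟩
  obtain ⟨e, he⟩ := h.exists_isInductiveAtom hne
  exact ⟨e, he.isDivisionalAtom, he.modularlyExtended_si⟩
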